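/- **Setup.** Let $k\in\mathbb N$ and, for $j\in\{1,\dots,k+1\}$, let $(\Omega_j,\mathscr F_j)$ be a measurable space, $H_j$ a complex Hilbert space (not necessarily separable) and $P_j\colon\mathscr F_j\to B(H_j)$ a projection-valued measure, i.e. $P_j(\Omega_j)=1$, $P_j(G)^2=P_j(G)=P_j(G)^*$ for $G\in\mathscr F_j$, and $P_j$ is countably additive in the weak operator topology. Put $\Omega=\Omega_1\times\cdots\times\Omega_{k+1}$ with the product $\sigma$-algebra $\mathscr F$, let $H_1\otimes_2\cdots\otimes_2H_{k+1}$ be the Hilbert space tensor product, and let $P=P_1\otimes\cdots\otimes P_{k+1}$ be the unique projection-valued measure on $(\Omega,\mathscr F)$ with values in $B(H_1\otimes_2\cdots\otimes_2H_{k+1})$ such that $P(G_1\times\cdots\times G_{k+1})=P_1(G_1)\otimes\cdots\otimes P_{k+1}(G_{k+1})$ for all $G_j\in\mathscr F_j$. For a projection-valued measure $Q$ on $(\Xi,\mathscr G)$, let $L^\infty(\Xi,Q)$ be the $*$-algebra of bounded measurable functions $\Xi\to\mathbb C$ modulo equality $Q$-almost everywhere, and let $\|f\|_{L^\infty(Q)}=\inf\{c\ge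 0: Q(\{|f|>c\})=0\}$ for measurable $f$. For a measure space $(\Sigma,\mathscr H,\rho)$ and an arbitrary $h\colon\Sigma\to[0,\infty]$, the upper integral is $$\overline{\int_\Sigma}h\,d\rho=\inf\Big\{\int_\Sigma\tilde h\,d\rho:\ \tilde h\colon\Sigma\to[0,\infty]\text{ measurable},\ h\le\tilde h\ \rho\text{-a.e.}\Big\}.$$ An *integral projective decomposition* of $\varphi\colon\Omega\to\mathbb C$ consists of a $\sigma$-finite measure space $(\Sigma,\mathscr H,\rho)$ and measurable functions $\varphi_j\colon\Omega_j\times\Sigma\to\mathbb C$ ($1\le j\le k+1$) such that $\|\varphi_j(\cdot,\sigma)\|_{L^\infty(P_j)}<\infty$ for all $j$ and all $\sigma\in\Sigma$, $$\overline{\int_\Sigma}\ \prod_{j=1}^{k+1}\|\varphi_j(\cdot,\sigma)\|_{L^\infty(P_j)}\,\rho(d\sigma)<\infty,\qquad(\ast)$$ and $\varphi(\omega_1,\dots,\omega_{k+1})=\int_\Sigma\prod_{j=1}^{k+1}\varphi_j(\omega_j,\sigma)\,\rho(d\sigma)$ for $P$-almost every $(\omega_1,\dots,\omega_{k+1})\in\Omega$.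 Let $\|\varphi\|_{\mathrm{IPTP}}\in[0,\infty]$ be the infimum of the numbers in $(\ast)$ over all integral projective decompositions of $\varphi$ (with $\inf\emptyset=\infty$); it depends only on the $P$-a.e. class of $\varphi$. The integral projective tensor product is $$\mathscr B=L^\infty(\Omega_1,P_1)\,\hat\otimes_i\cdots\hat\otimes_i\,L^\infty(\Omega_{k+1},P_{k+1})=\{\varphi\in L^\infty(\Omega,P):\|\varphi\|_{\mathrm{IPTP}}<\infty\}.$$ **Proposition 4.3 (Basic Properties of IPTPs).** If $\varphi\in\mathscr B$, then $\|\varphi\|_{L^\infty(P)}\le\|\varphi\|_{\mathrm{IPTP}}$. Moreover, $\mathscr B\subseteq L^\infty(\Omega,P)$ is a (unital) $*$-subalgebra, and $(\mathscr B,\|\cdot\|_{\mathrm{IPTP}})$ is a Banach $*$-algebra: $\|\cdot\|_{\mathrm{IPTP}}$ is a complete norm on $\mathscr B$ with $\|\varphi\psi\|_{\mathrm{IPTP}}\le\|\varphi\|_{\mathrm{IPTP}}\|\psi\|_{\mathrm{IPTP}}$ and $\|\overline\varphi\|_{\mathrm{IPTP}}=\|\varphi\|_{\mathrm{IPTP}}$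 for all $\varphi,\psi\in\mathscr B$, and $\|1\|_{\mathrm{IPTP}}=1$ unless $\mathscr B=\{0\}$. -/

import Mathlib

set_option linter.unusedSectionVars false

universe u v w

noncomputable section

namespace IPTP

open scoped TensorProduct

section HilbertTensor

variable {ι : Type*} [Fintype ι] (E : ι → Type*) [∀ i, NormedAddCommGroup (E i)]
  [∀ i, InnerProductSpace ℂ (E i)]

/-- The algebraic tensor product of the complex inner product spaces `E i`, a copy of Mathlib's
`PiTensorProduct` that carries the inner product below instead of the projective seminorm. -/
def AlgTensor : Type _ := ⨂[ℂ] i, E i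

instance : AddCommGroup (AlgTensor E) := inferInstanceAs (AddCommGroup (⨂[ℂ] i, E i))

instance : Module ℂ (AlgTensor E) := inferInstanceAs (Module ℂ (⨂[ℂ] i, E i))

variable {E}

/-- The pure tensor `⊗ᵢ h i`. -/
def algTprod (h : ∀ i, E i) : AlgTensor E := PiTensorProduct.tprod ℂ h

/-- A multilinear map, as a linear map on the algebraic tensor product. -/
def algLift {F : Type*} [AddCommGroup F] [Module ℂ F] (f : MultilinearMap ℂ E F) :
    AlgTensor E →ₗ[ℂ] F := PiTensorProduct.lift f

theorem algLift_algTprod {F : Type*} [AddCommGroup F] [Module ℂ F] (f : MultilinearMap ℂ E F)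
    (h : ∀ i, E i) : algLift f (algTprod h) = f h := PiTensorProduct.lift.tprod h

theorem algTensor_induction {p : AlgTensor E → Prop} (z : AlgTensor E)
    (smul : ∀ (r : ℂ) (h : ∀ i, E i), p (r • algTprod h))
    (add : ∀ x y, p x → p y → p (x + y)) : p z :=
  PiTensorProduct.induction_on z smul add

theorem algTensor_eq_sum (z : AlgTensor E) :
    ∃ (n : ℕ) (c : Fin n → ℂ) (h : Fin n → ∀ i, E i), z = ∑ a, c a • algTprod (h a) := by
  induction z using algTensor_induction with
  | smul r h => exact ⟨1, fun _ => r, fun _ => h, by simp⟩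
  | add x y hx hy =>
    obtain ⟨n, c, h, rfl⟩ := hx
    obtain ⟨m, d, k, rfl⟩ := hy
    exact ⟨n + m, Fin.append c d, Fin.append h k, by simp [Fin.sum_univ_add]⟩

/-- `x ↦ ⟨⊗ᵢ h i, x⟩` as a linear functional. -/
def innerPure (h : ∀ i, E i) : AlgTensor E →ₗ[ℂ] ℂ :=
  algLift
    ((MultilinearMap.mkPiAlgebra ℂ ι ℂ).compLinearMap fun i => innerₛₗ ℂ (h i))

@[simp] theorem innerPure_algTprod (h k : ∀ i, E i) :
    innerPure h (algTprod k) = ∏ i, inner ℂ (h i) (k i) := by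
  rw [innerPure, algLift_algTprod]
  simp

variable (E) in
/-- The tensor inner product, conjugate linear in the first entry: `innerForm E y x = ⟨x, y⟩`, determined by
`⟨⊗ᵢ h i, ⊗ᵢ k i⟩ = ∏ᵢ ⟨h i, k i⟩`. -/
def innerForm : AlgTensor E →ₗ[ℂ] AlgTensor E →ₗ⋆[ℂ] ℂ :=
  algLift
    { toFun := fun k => (starLinearEquiv ℂ : ℂ ≃ₗ⋆[ℂ] ℂ).toLinearMap ∘ₛₗ innerPure k
      map_update_add' := by
        intro _ k i x y
        ext z
        induction z using algTensor_induction with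
        | smul r h => 
          have e : ∏ j, inner ℂ (Function.update k i (x + y) j) (h j) =
              ∏ j, inner ℂ (Function.update k i x j) (h j) +
              ∏ j, inner ℂ (Function.update k i y j) (h j) := by
            simp [Function.apply_update (fun i (z : E i) => inner ℂ z (h i)),
              Finset.prod_update_of_mem, add_mul]
          simp [e, mul_add]
        | add z w hz hw => rw [map_add, map_add, hz, hw]
      map_update_smul' := by
        intro _ k i c x
        ext z
        induction z using algTensor_induction with
        | smul r h => 
          have e : ∏ j, inner ℂ (Function.update k i (c • x) j) (h j) =
              starRingEnd ℂ c * ∏ j, inner ℂ (Function.update k i x j) (h j) := by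
            simp [Function.apply_update (fun i (z : E i) => inner ℂ z (h i)),
              Finset.prod_update_of_mem, mul_assoc]
            ring
          simp only [map_smul, LinearMap.comp_apply, LinearMap.smul_apply, innerPure_algTprod, e]
          simp
          ring
        | add z w hz hw => rw [map_add, map_add, hz, hw] }

theorem innerForm_algTprod (h k : ∀ i, E i) :
    innerForm E (algTprod k) (algTprod h) = ∏ i, inner ℂ (h i) (k i) := by
  rw [innerForm, algLift_algTprod]
  change starRingEnd ℂ (innerPure k (algTprod h)) = _
  simp

open ComplexOrder in
theorem posSemidef_prod_gram {n : ℕ} (h : Fin n → ∀ i, E i) (s : Finset ι) :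
    (Matrix.of fun a b => ∏ i ∈ s, inner ℂ (h a i) (h b i)).PosSemidef := by
  classical
  induction s using Finset.induction_on with
  | empty =>
    have := Matrix.posSemidef_vecMulVec_self_star (fun _ : Fin n => (1 : ℂ))
    convert this using 1
    ext a b; simp [Matrix.vecMulVec]
  | insert i s hi ih =>
    have := (Matrix.posSemidef_gram ℂ (fun a => h a i)).hadamard ih
    have e : (Matrix.of fun a b => ∏ j ∈ insert i s, inner ℂ (h a j) (h b j)) =
        Matrix.hadamard (Matrix.gram ℂ fun a => h a i)
          (Matrix.of fun a b => ∏ j ∈ s, inner ℂ (h a j) (h b j)) := by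
      ext a b; simp [Finset.prod_insert hi, Matrix.gram]
    rw [e]; exact this

open ComplexOrder in
variable (E) in
/-- The tensor inner product as a positive semidefinite Hermitian form. -/
abbrev algCore : PreInnerProductSpace.Core ℂ (AlgTensor E) where
  inner x y := innerForm E y x
  conj_inner_symm x y := by
    induction x using algTensor_induction with
    | smul r h =>
      induction y using algTensor_induction with
      | smul s k => simp [innerForm_algTprod]; ring
      | add z w hz hw => simp only [map_add, LinearMap.add_apply, hz, hw]
    | add z w hz hw => simp only [map_add, LinearMap.add_apply, hz, hw]
  re_inner_nonneg x := by
    obtain ⟨n, c, h, rfl⟩ := algTensor_eq_sum x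
    have := (posSemidef_prod_gram h Finset.univ).dotProduct_mulVec_nonneg c
    have e : innerForm E (∑ a, c a • algTprod (h a)) (∑ a, c a • algTprod (h a)) =
        star c ⬝ᵥ (Matrix.of fun a b => ∏ i, inner ℂ (h a i) (h b i)).mulVec c := by
      simp only [map_sum, LinearMap.sum_apply, map_smulₛₗ, LinearMap.smul_apply,
        innerForm_algTprod, dotProduct, Matrix.mulVec, Finset.mul_sum, Matrix.of_apply,
        Finset.smul_sum]
      refine Finset.sum_congr rfl fun a _ => Finset.sum_congr rfl fun b _ => ?_
      simp only [RingHom.id_apply, smul_eq_mul, Pi.star_apply, RCLike.star_def]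
      ring
    change 0 ≤ (innerForm E _ _).re
    rw [e]
    exact (Complex.le_def.1 this).1
  add_left x y z := by simp
  smul_left x y r := by simp

instance : SeminormedAddCommGroup (AlgTensor E) :=
  @InnerProductSpace.Core.toSeminormedAddCommGroup ℂ _ _ _ _ (algCore E)

instance : InnerProductSpace ℂ (AlgTensor E) := InnerProductSpace.ofCore (algCore E)

theorem inner_algTprod (h k : ∀ i, E i) :
    inner ℂ (algTprod h) (algTprod k) = ∏ i, inner ℂ (h i) (k i) := innerForm_algTprod h k

variable (E) in
/-- The Hilbert space tensor product `⊗₂ᵢ E i`: the completion of the algebraic tensor product with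
respect to the tensor inner product. -/
abbrev HilbertTensor : Type _ := UniformSpace.Completion (AlgTensor E)

/-- The pure tensor `⊗ᵢ h i` in the Hilbert space tensor product. -/
def hTprod (h : ∀ i, E i) : HilbertTensor E := (algTprod h : AlgTensor E)

theorem inner_hTprod (h k : ∀ i, E i) :
    inner ℂ (hTprod h) (hTprod k) = ∏ i, inner ℂ (h i) (k i) := by
  rw [hTprod, hTprod, UniformSpace.Completion.inner_coe, inner_algTprod]

end HilbertTensor

section PVM

/-- A projection-valued measure on a measurable space: `P Ω = 1`, every `P G` with `G` measurable is an
orthogonal projection, and `P` is countably additive in the weak operator topology. (The values at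
non-measurable sets carry no information and are never used.) -/
structure ProjectionValuedMeasure (Ω : Type*) [MeasurableSpace Ω] (H : Type*)
    [NormedAddCommGroup H] [InnerProductSpace ℂ H] [CompleteSpace H] where
  toFun : Set Ω → H →L[ℂ] H
  univ' : toFun Set.univ = 1
  isStarProjection' : ∀ G, MeasurableSet G → IsStarProjection (toFun G)
  hasSum' : ∀ G : ℕ → Set Ω, (∀ n, MeasurableSet (G n)) → Pairwise (Function.onFun Disjoint G) →
    ∀ x y : H, HasSum (fun n => inner ℂ y (toFun (G n) x)) (inner ℂ y (toFun (⋃ n, G n) x))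

instance {Ω : Type*} [MeasurableSpace Ω] {H : Type*}
    [NormedAddCommGroup H] [InnerProductSpace ℂ H] [CompleteSpace H] :
    CoeFun (ProjectionValuedMeasure Ω H) (fun _ => Set Ω → H →L[ℂ] H) :=
  ⟨ProjectionValuedMeasure.toFun⟩

variable {H : Type*} [NormedAddCommGroup H] [InnerProductSpace ℂ H] [CompleteSpace H]

section proj

variable {S T : H →L[ℂ] H}

theorem proj_inner (hT : IsStarProjection T) (x y : H) : inner ℂ (T x) y = inner ℂ x (T y) := by
  have := hT.isSelfAdjoint.isSymmetric x y
  simpa using this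

theorem proj_apply (hT : IsStarProjection T) (x : H) : T (T x) = T x :=
  congrArg (fun f : H →L[ℂ] H => f x) hT.isIdempotentElem

theorem proj_inner_self (hT : IsStarProjection T) (x : H) :
    inner ℂ x (T x) = ((‖T x‖ ^ 2 : ℝ) : ℂ) := by
  rw [← proj_apply hT, ← proj_inner hT, inner_self_eq_norm_sq_to_K]
  rw [proj_apply hT]; simp

theorem proj_sq (hT : IsStarProjection T) (x : H) :
    ‖x - T x‖ ^ 2 = ‖x‖ ^ 2 - ‖T x‖ ^ 2 := by
  have h := norm_sub_sq (𝕜 := ℂ) x (T x)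
  rw [proj_inner_self hT] at h
  rw [h]
  simp only [RCLike.re_to_complex, Complex.ofReal_re]
  ring

theorem proj_norm_le (hT : IsStarProjection T) (x : H) : ‖T x‖ ≤ ‖x‖ := by
  have := proj_sq hT x
  exact (sq_le_sq₀ (norm_nonneg _) (norm_nonneg _)).1 (by nlinarith [sq_nonneg ‖x - T x‖])

theorem proj_mul_eq_zero (hT : IsStarProjection T)
    (h : ∀ x, ‖S x‖ ^ 2 + ‖T x‖ ^ 2 ≤ ‖x‖ ^ 2) : S * T = 0 := by
  ext x
  have := h (T x)
  rw [proj_apply hT] at this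
  have h0 : ‖S (T x)‖ ^ 2 = 0 := le_antisymm (by linarith) (sq_nonneg _)
  simpa using h0

theorem proj_ext (hS : IsStarProjection S) (hT : IsStarProjection T)
    (h : ∀ x, ‖S x‖ ^ 2 = ‖T x‖ ^ 2) : S = T := by
  have : (S : H →ₗ[ℂ] H) = T := by
    rw [← ext_inner_map]
    intro x
    rw [← inner_conj_symm, ← inner_conj_symm (T.toLinearMap x)]
    congr 1
    simp only [ContinuousLinearMap.coe_coe]
    rw [proj_inner_self hS, proj_inner_self hT, h]
  exact ContinuousLinearMap.coe_injective this

end proj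

namespace ProjectionValuedMeasure

variable {Ω : Type*} [MeasurableSpace Ω] (P : ProjectionValuedMeasure Ω H)

theorem empty : P ∅ = 0 := by
  ext x
  refine ext_inner_left ℂ fun y => ?_
  have h := P.hasSum' (fun _ => ∅) (fun _ => .empty) (fun _ _ _ => by simp [Function.onFun]) x y
  have := h.summable.tendsto_atTop_zero
  simpa using tendsto_nhds_unique tendsto_const_nhds this

/-- The finite measure `G ↦ ⟨P G x, x⟩ = ‖P G x‖²`. -/
def diag (x : H) : MeasureTheory.Measure Ω :=
  MeasureTheory.Measure.ofMeasurable (fun G _ => ENNReal.ofReal (‖P G x‖ ^ 2))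
    (by simp [P.empty]) (by
      intro f hf hd
      have h := Complex.hasSum_iff _ _ |>.1 (P.hasSum' f hf hd x x) |>.1
      simp only [proj_inner_self (P.isStarProjection' _ (hf _)),
        proj_inner_self (P.isStarProjection' _ (MeasurableSet.iUnion hf)),
        Complex.ofReal_re] at h
      rw [← h.tsum_eq, ENNReal.ofReal_tsum_of_nonneg (fun _ => by positivity) h.summable])

theorem diag_apply (x : H) {G : Set Ω} (hG : MeasurableSet G) :
    P.diag x G = ENNReal.ofReal (‖P G x‖ ^ 2) :=
  MeasureTheory.Measure.ofMeasurable_apply G hG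

instance (x : H) : MeasureTheory.IsFiniteMeasure (P.diag x) :=
  ⟨by rw [diag_apply _ _ .univ]; exact ENNReal.ofReal_lt_top⟩

theorem eq_zero_iff {G : Set Ω} (hG : MeasurableSet G) :
    P G = 0 ↔ ∀ x, P.diag x G = 0 := by
  simp [diag_apply, hG, ContinuousLinearMap.ext_iff]

theorem union {A B : Set Ω} (hA : MeasurableSet A) (hB : MeasurableSet B) (h : Disjoint A B)
    (x : H) : ‖P (A ∪ B) x‖ ^ 2 = ‖P A x‖ ^ 2 + ‖P B x‖ ^ 2 := by
  have := MeasureTheory.measure_union (μ := P.diag x) h hB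
  rw [diag_apply _ _ hA, diag_apply _ _ hB, diag_apply _ _ (hA.union hB),
    ← ENNReal.ofReal_add (by positivity) (by positivity)] at this
  exact (ENNReal.ofReal_eq_ofReal_iff (by positivity) (by positivity)).1 this

theorem mul_of_disjoint {A B : Set Ω} (hA : MeasurableSet A) (hB : MeasurableSet B)
    (h : Disjoint A B) : P A * P B = 0 := by
  refine proj_mul_eq_zero (P.isStarProjection' _ hB) fun x => ?_
  rw [← P.union hA hB h]
  have := proj_norm_le (P.isStarProjection' _ (hA.union hB)) x
  gcongr

theorem add_of_disjoint {A B : Set Ω} (hA : MeasurableSet A) (hB : MeasurableSet B)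
    (h : Disjoint A B) : P (A ∪ B) = P A + P B := by
  refine proj_ext (P.isStarProjection' _ (hA.union hB)) ?_ fun x => ?_
  · exact (P.isStarProjection' _ hA).add (P.isStarProjection' _ hB) (P.mul_of_disjoint hA hB h)
  · rw [P.union hA hB h]
    have : inner ℂ (P A x) (P B x) = (0 : ℂ) := by
      rw [proj_inner (P.isStarProjection' _ hA)]
      have := congrArg (fun f : H →L[ℂ] H => f x) (P.mul_of_disjoint hA hB h)
      simp only [mul_apply_eq_comp, zero_apply] at this
      rw [this, inner_zero_right]
    rw [add_apply, sq ‖P A x + P B x‖,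
      norm_add_sq_eq_norm_sq_add_norm_sq_of_inner_eq_zero _ _ this]
    ring

theorem mul_eq {A B : Set Ω} (hA : MeasurableSet A) (hB : MeasurableSet B) :
    P A * P B = P (A ∩ B) := by
  have h1 : P A = P (A ∩ B) + P (A \ B) := by
    rw [← P.add_of_disjoint (hA.inter hB) (hA.diff hB) Set.disjoint_sdiff_inter.symm,
      Set.inter_union_sdiff]
  have h2 : P B = P (A ∩ B) + P (B \ A) := by
    rw [← P.add_of_disjoint (hA.inter hB) (hB.diff hA), Set.inter_comm, Set.inter_union_sdiff]
    rw [Set.inter_comm]; exact Set.disjoint_sdiff_inter.symm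
  have h3 : P (A ∩ B) * P (B \ A) = 0 := P.mul_of_disjoint (hA.inter hB) (hB.diff hA)
    (Set.disjoint_left.2 fun x hx hx' => hx'.2 hx.1)
  have h4 : P (A \ B) * P B = 0 := P.mul_of_disjoint (hA.diff hB) hB Set.disjoint_sdiff_left
  conv_lhs => rw [h1, add_mul, h4, h2, mul_add, h3]
  rw [(P.isStarProjection' _ (hA.inter hB)).isIdempotentElem.eq]; simp

/-- The filter of sets that hold `P`-almost everywhere: their complement is contained in a measurable
set `N` with `P N = 0`. -/
def ae : Filter Ω where
  sets := {s | ∃ N, MeasurableSet N ∧ P N = 0 ∧ sᶜ ⊆ N}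
  univ_sets := ⟨∅, .empty, P.empty, by simp⟩
  sets_of_superset := by
    rintro s t ⟨N, hN, h0, hs⟩ hst
    exact ⟨N, hN, h0, (Set.compl_subset_compl.2 hst).trans hs⟩
  inter_sets := by
    rintro s t ⟨N, hN, h0, hs⟩ ⟨M, hM, h1, ht⟩
    refine ⟨N ∪ M, hN.union hM, ?_, ?_⟩
    · rw [P.eq_zero_iff hN] at h0
      rw [P.eq_zero_iff hM] at h1
      rw [P.eq_zero_iff (hN.union hM)]
      exact fun x => MeasureTheory.measure_union_null (h0 x) (h1 x)
    · rw [Set.compl_inter]; exact Set.union_subset_union hs ht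

end ProjectionValuedMeasure
end PVM

section TensorPVM

variable {ι : Type*} [Fintype ι] {E : ι → Type*} [∀ i, NormedAddCommGroup (E i)]
  [∀ i, InnerProductSpace ℂ (E i)]

theorem hilbertTensor_ext {F : Type*} [NormedAddCommGroup F] [NormedSpace ℂ F]
    {S T : HilbertTensor E →L[ℂ] F} (h : ∀ k, S (hTprod k) = T (hTprod k)) : S = T := by
  ext z
  induction z using UniformSpace.Completion.induction_on with
  | hp => exact isClosed_eq S.continuous T.continuous
  | ih z =>
    induction z using algTensor_induction with
    | smul r k =>
      rw [UniformSpace.Completion.coe_smul, map_smul, map_smul]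
      exact congrArg _ (h k)
    | add x y hx hy => rw [UniformSpace.Completion.coe_add, map_add, map_add, hx, hy]

theorem hilbertTensor_tendsto_zero (S : ℕ → HilbertTensor E →L[ℂ] HilbertTensor E)
    (hS : ∀ n x, ‖S n x‖ ≤ ‖x‖)
    (h : ∀ k, Filter.Tendsto (fun n => S n (hTprod k)) Filter.atTop (nhds 0))
    (x : HilbertTensor E) : Filter.Tendsto (fun n => S n x) Filter.atTop (nhds 0) := by
  have hc : ∀ z : AlgTensor E,
      Filter.Tendsto (fun n => S n (z : HilbertTensor E)) Filter.atTop (nhds 0) := by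
    intro z
    induction z using algTensor_induction with
    | smul r k =>
      simp only [UniformSpace.Completion.coe_smul, map_smul]
      have := (h k).const_smul r
      rw [smul_zero] at this
      exact this
    | add x y hx hy =>
      simp only [UniformSpace.Completion.coe_add, map_add]
      simpa using hx.add hy
  rw [Metric.tendsto_atTop]
  intro ε hε
  obtain ⟨_, ⟨z, rfl⟩, hz⟩ := Metric.mem_closure_iff.1
    (UniformSpace.Completion.denseRange_coe (α := AlgTensor E) x) (ε / 2) (half_pos hε)
  obtain ⟨N, hN⟩ := Metric.tendsto_atTop.1 (hc z) (ε / 2) (half_pos hε)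
  refine ⟨N, fun n hn => ?_⟩
  have h1 := hN n hn
  rw [dist_zero_right] at h1 ⊢
  have h2 := hS n (x - (z : HilbertTensor E))
  rw [dist_eq_norm] at hz
  have h3 : S n x = S n (x - (z : HilbertTensor E)) + S n (z : HilbertTensor E) := by
    rw [← map_add, sub_add_cancel]
  rw [h3]
  exact (norm_add_le _ _).trans_lt (by linarith)

variable [∀ i, CompleteSpace (E i)]

theorem exists_tensorProj (A : ∀ i, E i →L[ℂ] E i) (hA : ∀ i, IsStarProjection (A i)) :
    ∃ T : HilbertTensor E →L[ℂ] HilbertTensor E, IsStarProjection T ∧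
      ∀ k, T (hTprod k) = hTprod fun i => A i (k i) := by
  let f : AlgTensor E →ₗ[ℂ] AlgTensor E :=
    algLift ((PiTensorProduct.tprod ℂ).compLinearMap fun i => (A i).toLinearMap)
  have hf : ∀ k, f (algTprod k) = algTprod fun i => A i (k i) := fun k => algLift_algTprod _ _
  have hff : ∀ x, f (f x) = f x := by
    intro x
    induction x using algTensor_induction with
    | smul r k => simp only [map_smul, hf, proj_apply (hA _)]
    | add x y hx hy => simp only [map_add, hx, hy]
  have hsym : ∀ x y, inner ℂ (f x) y = inner ℂ x (f y) := by
    intro x y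
    induction x using algTensor_induction with
    | smul r k =>
      induction y using algTensor_induction with
      | smul s l =>
        simp only [map_smul, hf, inner_smul_left, inner_smul_right, inner_algTprod,
          proj_inner (hA _)]
      | add z w hz hw => simp only [map_add, inner_add_right, hz, hw]
    | add z w hz hw => simp only [map_add, inner_add_left, hz, hw]
  have hnorm : ∀ x, ‖f x‖ ≤ 1 * ‖x‖ := by
    intro x
    rw [one_mul]
    have h1 : inner ℂ (f x) (f x) = inner ℂ x (f x) := by rw [hsym, hff]
    have h2 : ‖f x‖ * ‖f x‖ ≤ ‖x‖ * ‖f x‖ := by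
      rw [← sq, ← inner_self_eq_norm_sq (𝕜 := ℂ), h1]
      exact (RCLike.re_le_norm _).trans (norm_inner_le_norm _ _)
    by_cases h0 : ‖f x‖ = 0
    · rw [h0]; positivity
    · exact le_of_mul_le_mul_right h2 (lt_of_le_of_ne (norm_nonneg _) (Ne.symm h0))
  let g : AlgTensor E →L[ℂ] AlgTensor E := f.mkContinuous 1 hnorm
  have hgf : ∀ x : AlgTensor E, g.completion (x : HilbertTensor E) = ((f x : AlgTensor E) :) :=
    fun x => g.completion_apply_coe x
  refine ⟨g.completion, ⟨?_, ?_⟩, ?_⟩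
  · refine hilbertTensor_ext fun k => ?_
    rw [mul_apply_eq_comp, hTprod, hgf, hgf, hff]
  · rw [ContinuousLinearMap.isSelfAdjoint_iff_isSymmetric]
    intro x y
    change inner ℂ (g.completion x) y = inner ℂ x (g.completion y)
    induction x, y using UniformSpace.Completion.induction_on₂ with
    | hp =>
      exact isClosed_eq (by fun_prop) (by fun_prop)
    | ih x y => rw [hgf, hgf, UniformSpace.Completion.inner_coe, UniformSpace.Completion.inner_coe,
        hsym]
  · intro k
    rw [hTprod, hgf, hf, hTprod]

variable {Ω : ι → Type*} [∀ i, MeasurableSpace (Ω i)]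
  (P : ∀ i, ProjectionValuedMeasure (Ω i) (E i))

open Classical in
/-- The projection `⊗ᵢ P i (t i)` on the Hilbert space tensor product. -/
def boxOp (t : ∀ i, Set (Ω i)) : HilbertTensor E →L[ℂ] HilbertTensor E :=
  if ht : ∀ i, MeasurableSet (t i) then
    (exists_tensorProj (fun i => P i (t i)) fun i => (P i).isStarProjection' _ (ht i)).choose
  else 0

section box

variable {P} {t s : ∀ i, Set (Ω i)}

theorem boxOp_proj (ht : ∀ i, MeasurableSet (t i)) : IsStarProjection (boxOp P t) := by
  rw [boxOp, dif_pos ht]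
  exact (exists_tensorProj (fun i => P i (t i)) fun i =>
    (P i).isStarProjection' _ (ht i)).choose_spec.1

theorem boxOp_hTprod (ht : ∀ i, MeasurableSet (t i)) (k : ∀ i, E i) :
    boxOp P t (hTprod k) = hTprod fun i => P i (t i) (k i) := by
  rw [boxOp, dif_pos ht]
  exact (exists_tensorProj (fun i => P i (t i)) fun i =>
    (P i).isStarProjection' _ (ht i)).choose_spec.2 k

theorem boxOp_mul (ht : ∀ i, MeasurableSet (t i)) (hs : ∀ i, MeasurableSet (s i)) :
    boxOp P t * boxOp P s = boxOp P fun i => t i ∩ s i := by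
  refine hilbertTensor_ext fun k => ?_
  rw [mul_apply_eq_comp, boxOp_hTprod hs, boxOp_hTprod ht,
    boxOp_hTprod fun i => (ht i).inter (hs i)]
  congr 1
  ext i
  rw [← (P i).mul_eq (ht i) (hs i)]
  rfl

theorem norm_hTprod (k : ∀ i, E i) : ‖hTprod k‖ ^ 2 = ∏ i, ‖k i‖ ^ 2 := by
  have h := inner_hTprod k k
  simp only [inner_self_eq_norm_sq_to_K] at h
  exact_mod_cast h

theorem boxOp_empty (ht : ∀ i, MeasurableSet (t i)) {i : ι} (hi : t i = ∅) : boxOp P t = 0 := by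
  refine hilbertTensor_ext fun k => ?_
  rw [boxOp_hTprod ht, zero_apply, ← norm_eq_zero, ← sq_eq_zero_iff, norm_hTprod]
  exact Finset.prod_eq_zero (Finset.mem_univ i) (by simp [hi, (P i).empty])

theorem boxOp_univ : boxOp P (fun _ => Set.univ) = 1 := by
  refine hilbertTensor_ext fun k => ?_
  rw [boxOp_hTprod fun _ => .univ]
  simp [(P _).univ']

variable (P) in
/-- The product of the measures `⟨P i (·) (k i), k i⟩`. -/
def pureMeasure (k : ∀ i, E i) : MeasureTheory.Measure (∀ i, Ω i) :=
  MeasureTheory.Measure.pi fun i => (P i).diag (k i)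

instance (k : ∀ i, E i) : MeasureTheory.IsFiniteMeasure (pureMeasure P k) := by
  unfold pureMeasure; infer_instance

theorem boxOp_pure (ht : ∀ i, MeasurableSet (t i)) (k : ∀ i, E i) :
    ‖boxOp P t (hTprod k)‖ ^ 2 = (pureMeasure P k).real (Set.univ.pi t) := by
  rw [boxOp_hTprod ht, norm_hTprod, MeasureTheory.measureReal_def, pureMeasure,
    MeasureTheory.Measure.pi_pi, ENNReal.toReal_prod]
  refine Finset.prod_congr rfl fun i _ => ?_
  rw [(P i).diag_apply _ (ht i), ENNReal.toReal_ofReal (by positivity)]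

variable (P) in
/-- The projection that belongs to the box `t` minus the first `n` boxes of the sequence `s`. -/
def boxSeq (t : ∀ i, Set (Ω i)) (s : ℕ → ∀ i, Set (Ω i)) :
    ℕ → HilbertTensor E →L[ℂ] HilbertTensor E
  | 0 => boxOp P t
  | n + 1 => boxSeq t s n - boxOp P (s n) * boxSeq t s n

variable {s : ℕ → ∀ i, Set (Ω i)}

theorem boxSeq_comm (ht : ∀ i, MeasurableSet (t i)) (hs : ∀ n i, MeasurableSet (s n i)) (n : ℕ)
    {r : ∀ i, Set (Ω i)} (hr : ∀ i, MeasurableSet (r i)) :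
    boxOp P r * boxSeq P t s n = boxSeq P t s n * boxOp P r := by
  have hcomm : ∀ q : ∀ i, Set (Ω i), (∀ i, MeasurableSet (q i)) →
      boxOp P r * boxOp P q = boxOp P q * boxOp P r := by
    intro q hq
    rw [boxOp_mul hr hq, boxOp_mul hq hr]
    simp only [Set.inter_comm]
  induction n with
  | zero => exact hcomm t ht
  | succ n ih =>
    rw [boxSeq, mul_sub, sub_mul, ih, ← mul_assoc, hcomm _ (hs n), mul_assoc, ih, mul_assoc]

theorem boxSeq_proj (ht : ∀ i, MeasurableSet (t i)) (hs : ∀ n i, MeasurableSet (s n i)) (n : ℕ) :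
    IsStarProjection (boxSeq P t s n) := by
  induction n with
  | zero => exact boxOp_proj ht
  | succ n ih =>
    have h1 := (boxOp_proj (P := P) (hs n)).one_sub
    have h2 : boxSeq P t s (n + 1) = (1 - boxOp P (s n)) * boxSeq P t s n := by
      rw [boxSeq, sub_mul, one_mul]
    rw [h2]
    refine h1.mul ih ?_
    rw [Commute, SemiconjBy, sub_mul, mul_sub, one_mul, mul_one, boxSeq_comm ht hs n (hs n)]

theorem boxSeq_pure (ht : ∀ i, MeasurableSet (t i)) (hs : ∀ n i, MeasurableSet (s n i)) (n : ℕ)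
    (k : ∀ i, E i) {r : ∀ i, Set (Ω i)} (hr : ∀ i, MeasurableSet (r i)) :
    inner ℂ (hTprod k) ((boxOp P r * boxSeq P t s n) (hTprod k)) =
      (((pureMeasure P k).real
        ((Set.univ.pi r ∩ Set.univ.pi t) \ ⋃ m < n, Set.univ.pi (s m)) : ℝ) : ℂ) := by
  induction n generalizing r with
  | zero =>
    rw [boxSeq, boxOp_mul hr ht, proj_inner_self (boxOp_proj fun i => (hr i).inter (ht i)),
      boxOp_pure fun i => (hr i).inter (ht i), Set.pi_inter_distrib]
    simp
  | succ n ih =>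
    rw [boxSeq, mul_sub, ← mul_assoc, boxOp_mul hr (hs n), sub_apply,
      inner_sub_right, ih hr, ih fun i => (hr i).inter (hs n i), ← Complex.ofReal_sub]
    congr 1
    have hm : MeasurableSet (((Set.univ.pi fun i => r i ∩ s n i) ∩ Set.univ.pi t) \
        ⋃ m < n, Set.univ.pi (s m)) :=
      ((MeasurableSet.univ_pi fun i => (hr i).inter (hs n i)).inter
        (MeasurableSet.univ_pi ht)).diff
        (MeasurableSet.iUnion fun m => MeasurableSet.iUnion fun _ => MeasurableSet.univ_pi (hs m))
    rw [← MeasureTheory.measureReal_sdiff ?_ hm]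
    · congr 1
      rw [Set.pi_inter_distrib, Set.biUnion_lt_succ]
      ext x
      simp only [Set.mem_sdiff, Set.mem_inter_iff, Set.mem_union]
      tauto
    · rw [Set.pi_inter_distrib]
      exact Set.sdiff_subset_sdiff_left fun x hx => ⟨hx.1.1, hx.2⟩

theorem boxSeq_norm_succ (hs : ∀ n i, MeasurableSet (s n i))
    (n : ℕ) (x : HilbertTensor E) :
    ‖boxSeq P t s (n + 1) x‖ ^ 2 =
      ‖boxSeq P t s n x‖ ^ 2 - ‖boxOp P (s n) (boxSeq P t s n x)‖ ^ 2 := by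
  rw [boxSeq]
  exact proj_sq (boxOp_proj (hs n)) _

theorem boxSeq_tendsto (ht : ∀ i, MeasurableSet (t i)) (hs : ∀ n i, MeasurableSet (s n i))
    (hts : Set.univ.pi t ⊆ ⋃ n, Set.univ.pi (s n)) (x : HilbertTensor E) :
    Filter.Tendsto (fun n => ‖boxSeq P t s n x‖ ^ 2) Filter.atTop (nhds 0) := by
  have h := hilbertTensor_tendsto_zero (boxSeq P t s)
    (fun n x => proj_norm_le (boxSeq_proj ht hs n) x) (fun k => ?_) x
  · simpa using (h.norm.pow 2)
  have h1 : ∀ n, ‖boxSeq P t s n (hTprod k)‖ ^ 2 =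
      (pureMeasure P k).real (Set.univ.pi t \ ⋃ m < n, Set.univ.pi (s m)) := by
    intro n
    have := boxSeq_pure (P := P) ht hs n k (r := fun _ => Set.univ) fun _ => .univ
    rw [boxOp_univ, one_mul, proj_inner_self (boxSeq_proj ht hs n)] at this
    have := Complex.ofReal_injective this
    simpa using this
  have h2 : Filter.Tendsto (fun n => (pureMeasure P k)
      (Set.univ.pi t \ ⋃ m < n, Set.univ.pi (s m))) Filter.atTop (nhds 0) := by
    have := MeasureTheory.tendsto_measure_iInter_atTop (μ := pureMeasure P k)
      (s := fun n => Set.univ.pi t \ ⋃ m < n, Set.univ.pi (s m)) (fun n =>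
        ((MeasurableSet.univ_pi ht).diff (MeasurableSet.iUnion fun m =>
          MeasurableSet.iUnion fun _ => MeasurableSet.univ_pi (hs m))).nullMeasurableSet)
      (fun a b hab => Set.sdiff_subset_sdiff_right
        (Set.biUnion_subset_biUnion_left fun m hm => lt_of_lt_of_le hm hab))
      ⟨0, MeasureTheory.measure_ne_top _ _⟩
    have h0 : (⋂ n, Set.univ.pi t \ ⋃ m < n, Set.univ.pi (s m)) = ∅ := by
      rw [Set.eq_empty_iff_forall_notMem]
      intro z hz
      rw [Set.mem_iInter] at hz
      obtain ⟨n, hn⟩ := Set.mem_iUnion.1 (hts (hz 0).1)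
      exact (hz (n + 1)).2 (Set.mem_iUnion₂.2 ⟨n, Nat.lt_succ_self n, hn⟩)
    rwa [h0, MeasureTheory.measure_empty] at this
  have h3 : Filter.Tendsto (fun n => ‖boxSeq P t s n (hTprod k)‖ ^ 2) Filter.atTop (nhds 0) := by
    simp only [h1, MeasureTheory.measureReal_def]
    exact (ENNReal.tendsto_toReal ENNReal.zero_ne_top).comp h2
  rw [tendsto_zero_iff_norm_tendsto_zero]
  have := h3.sqrt
  simpa [Real.sqrt_sq] using this

theorem box_sum_eq (hs : ∀ n i, MeasurableSet (s n i))
    (x : HilbertTensor E) (n : ℕ) :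
    ‖boxOp P t x‖ ^ 2 = ‖boxSeq P t s n x‖ ^ 2 +
      ∑ m ∈ Finset.range n, ‖boxOp P (s m) (boxSeq P t s m x)‖ ^ 2 := by
  induction n with
  | zero => simp [boxSeq]
  | succ n ih => rw [Finset.sum_range_succ, boxSeq_norm_succ hs, ih]; ring

theorem box_le_tsum (ht : ∀ i, MeasurableSet (t i)) (hs : ∀ n i, MeasurableSet (s n i))
    (hts : Set.univ.pi t ⊆ ⋃ n, Set.univ.pi (s n)) (x : HilbertTensor E) :
    ENNReal.ofReal (‖boxOp P t x‖ ^ 2) ≤ ∑' n, ENNReal.ofReal (‖boxOp P (s n) x‖ ^ 2) := by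
  have h1 : ∀ n, ENNReal.ofReal (‖boxOp P t x‖ ^ 2) ≤ ENNReal.ofReal (‖boxSeq P t s n x‖ ^ 2) +
      ∑' n, ENNReal.ofReal (‖boxOp P (s n) x‖ ^ 2) := by
    intro n
    rw [box_sum_eq hs x n, ENNReal.ofReal_add (by positivity) (by positivity),
      ENNReal.ofReal_sum_of_nonneg fun _ _ => by positivity]
    gcongr
    refine (Finset.sum_le_sum fun m _ => ?_).trans (ENNReal.sum_le_tsum (Finset.range n))
    refine ENNReal.ofReal_le_ofReal ?_
    have h := congrArg (fun f : HilbertTensor E →L[ℂ] HilbertTensor E => f x)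
      (boxSeq_comm (P := P) ht hs m (hs m))
    simp only [mul_apply_eq_comp] at h
    rw [h]
    have := proj_norm_le (boxSeq_proj (P := P) ht hs m) (boxOp P (s m) x)
    gcongr
  have h2 : Filter.Tendsto (fun n => ENNReal.ofReal (‖boxSeq P t s n x‖ ^ 2) +
      ∑' n, ENNReal.ofReal (‖boxOp P (s n) x‖ ^ 2)) Filter.atTop
      (nhds (0 + ∑' n, ENNReal.ofReal (‖boxOp P (s n) x‖ ^ 2))) := by
    refine Filter.Tendsto.add ?_ tendsto_const_nhds
    have := (ENNReal.continuous_ofReal.tendsto 0).comp (boxSeq_tendsto (P := P) ht hs hts x)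
    rw [ENNReal.ofReal_zero] at this
    exact this
  rw [zero_add] at h2
  exact ge_of_tendsto' h2 h1

theorem tsum_le_box (ht : ∀ i, MeasurableSet (t i)) (hs : ∀ n i, MeasurableSet (s n i))
    (hd : Pairwise (Function.onFun Disjoint fun n => Set.univ.pi (s n)))
    (hst : ∀ n, Set.univ.pi (s n) ⊆ Set.univ.pi t) (x : HilbertTensor E) :
    ∑' n, ENNReal.ofReal (‖boxOp P (s n) x‖ ^ 2) ≤ ENNReal.ofReal (‖boxOp P t x‖ ^ 2) := by
  have h0 : ∀ n, boxOp P (s n) * boxOp P t = boxOp P (s n) := by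
    intro n
    rw [boxOp_mul (hs n) ht]
    by_cases he : ∃ i, s n i = ∅
    · obtain ⟨i, hi⟩ := he
      rw [boxOp_empty (hs n) hi, boxOp_empty (i := i) (fun i => (hs n i).inter (ht i)) (by simp [hi])]
    · congr 1
      ext1 i
      refine Set.inter_eq_left.2 ?_
      have hne : (Set.univ.pi (s n)).Nonempty := by
        rw [Set.univ_pi_nonempty_iff]
        exact fun i => Set.nonempty_iff_ne_empty.2 fun h => he ⟨i, h⟩
      rw [← Set.eval_image_univ_pi hne]
      rintro _ ⟨z, hz, rfl⟩
      exact hst n hz i (Set.mem_univ i)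
  have h1 : ∀ n m, n ≠ m → boxOp P (s n) * boxOp P (s m) = 0 := by
    intro n m hnm
    rw [boxOp_mul (hs n) (hs m)]
    have := hd hnm
    rw [Function.onFun, Set.disjoint_iff_inter_eq_empty, ← Set.pi_inter_distrib,
      Set.univ_pi_eq_empty_iff] at this
    obtain ⟨i, hi⟩ := this
    exact boxOp_empty (fun i => (hs n i).inter (hs m i)) hi
  have h2 : ∀ n m, m ≤ n → boxOp P (s n) * boxSeq P t s m = boxOp P (s n) := by
    intro n m
    induction m with
    | zero => exact fun _ => h0 n
    | succ m ih =>
      intro hm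
      rw [boxSeq, mul_sub, ih (Nat.le_of_succ_le hm), ← mul_assoc, h1 n m (by omega), zero_mul,
        sub_zero]
  refine ENNReal.tsum_le_of_sum_range_le fun n => ?_
  rw [← ENNReal.ofReal_sum_of_nonneg fun _ _ => by positivity]
  refine ENNReal.ofReal_le_ofReal ?_
  rw [box_sum_eq hs x n]
  refine le_trans (le_of_eq ?_) (le_add_of_nonneg_left (by positivity))
  refine Finset.sum_congr rfl fun m _ => ?_
  conv_lhs => rw [← h2 m m le_rfl]
  rfl


/-- The measurable boxes `∏ᵢ t i`. -/
def boxes (Ω : ι → Type*) [∀ i, MeasurableSpace (Ω i)] : Set (Set (∀ i, Ω i)) :=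
  {R | ∃ t : ∀ i, Set (Ω i), (∀ i, MeasurableSet (t i)) ∧ R = Set.univ.pi t}

theorem boxes_semiring [Nonempty ι] : MeasureTheory.IsSetSemiring (boxes Ω) := by
  classical
  refine ⟨⟨fun _ => ∅, fun _ => .empty, (Set.univ_pi_empty).symm⟩, ?_, ?_⟩
  · rintro _ ⟨t, ht, rfl⟩ _ ⟨s, hs, rfl⟩
    exact ⟨fun i => t i ∩ s i, fun i => (ht i).inter (hs i), Set.pi_inter_distrib.symm⟩
  · rintro _ ⟨t, ht, rfl⟩ _ ⟨s, hs, rfl⟩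
    let b : Finset ι → ∀ i, Set (Ω i) := fun a i => if i ∈ a then t i ∩ s i else t i \ s i
    refine ⟨(Finset.univ.erase Finset.univ).image fun a => Set.univ.pi (b a), ?_, ?_, ?_⟩
    · intro R hR
      simp only [Finset.coe_image, Set.mem_image] at hR
      obtain ⟨a, -, rfl⟩ := hR
      refine ⟨b a, fun i => ?_, rfl⟩
      by_cases h : i ∈ a <;> simp only [b, h, if_true, if_false]
      · exact (ht i).inter (hs i)
      · exact (ht i).diff (hs i)
    · intro R hR R' hR' hne
      simp only [Finset.coe_image, Set.mem_image] at hR hR'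
      obtain ⟨a, -, rfl⟩ := hR
      obtain ⟨a', -, rfl⟩ := hR'
      refine Set.disjoint_left.2 fun x hx hx' => hne ?_
      have : a = a' := by
        ext i
        have h1 := hx i (Set.mem_univ i)
        have h2 := hx' i (Set.mem_univ i)
        by_cases h : i ∈ a <;> by_cases h' : i ∈ a' <;> simp [b, h, h'] at h1 h2 ⊢ <;> tauto
      rw [this]
    · ext x
      simp only [Set.mem_sdiff, Set.mem_sUnion, Finset.coe_image, Set.mem_image]
      constructor
      · rintro ⟨hx, hx'⟩
        refine ⟨_, ⟨Finset.univ.filter fun i => x i ∈ s i, ?_, rfl⟩, ?_⟩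
        · simp only [Finset.coe_erase, Set.mem_sdiff, Finset.mem_coe, Finset.mem_univ,
            Set.mem_singleton_iff, true_and]
          intro h
          refine hx' fun i _ => ?_
          have := Finset.mem_univ i
          rw [← h] at this
          simpa using this
        · intro i _
          have := hx i (Set.mem_univ i)
          by_cases h : x i ∈ s i <;> simp [b, h, this]
      · rintro ⟨_, ⟨a, ha, rfl⟩, hx⟩
        refine ⟨fun i _ => ?_, fun h => ?_⟩
        · have := hx i (Set.mem_univ i)
          by_cases h : i ∈ a <;> simp [b, h] at this <;> exact this.1
        · simp only [Finset.coe_erase, Set.mem_sdiff, Finset.mem_coe, Finset.mem_univ,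
            Set.mem_singleton_iff, true_and] at ha
          refine ha (Finset.eq_univ_iff_forall.2 fun i => ?_)
          by_contra hi
          have := hx i (Set.mem_univ i)
          simp only [b, hi, if_false] at this
          exact this.2 (h i (Set.mem_univ i))

theorem boxes_gen : (MeasurableSpace.pi : MeasurableSpace (∀ i, Ω i)) =
    MeasurableSpace.generateFrom (boxes Ω) := by
  rw [← generateFrom_pi]
  congr 1
  ext R
  simp only [boxes, Set.mem_image, Set.mem_ofPred_eq, Set.mem_univ_pi]
  exact ⟨fun ⟨t, ht, h⟩ => ⟨t, ht, h.symm⟩, fun ⟨t, ht, h⟩ => ⟨t, ht, h.symm⟩⟩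

variable (P) in
/-- The set function `R ↦ ‖P⁰ R x‖²` on boxes. -/
def boxMass (x : HilbertTensor E) (R : Set (∀ i, Ω i)) : ENNReal :=
  ENNReal.ofReal (‖boxOp P (fun i => Function.eval i '' R) x‖ ^ 2)

theorem boxMass_empty [Nonempty ι] (x : HilbertTensor E) : boxMass P x ∅ = 0 := by
  obtain ⟨i⟩ := ‹Nonempty ι›
  rw [boxMass, boxOp_empty (i := i) (by simp) (by simp)]
  simp

theorem boxMass_pi [Nonempty ι] (ht : ∀ i, MeasurableSet (t i)) (x : HilbertTensor E) :
    boxMass P x (Set.univ.pi t) = ENNReal.ofReal (‖boxOp P t x‖ ^ 2) := by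
  by_cases h : Set.univ.pi t = ∅
  · rw [h, boxMass_empty]
    obtain ⟨i, hi⟩ := Set.univ_pi_eq_empty_iff.1 h
    simp [boxOp_empty ht hi]
  · have : (fun i => Function.eval i '' Set.univ.pi t) = t :=
      funext fun i => Set.eval_image_univ_pi (Set.nonempty_iff_ne_empty.2 h)
    rw [boxMass, this]

theorem boxMass_tsum [Nonempty ι] {f : ℕ → Set (∀ i, Ω i)} (hf : ∀ n, f n ∈ boxes Ω)
    (hu : (⋃ n, f n) ∈ boxes Ω) (x : HilbertTensor E) :
    boxMass P x (⋃ n, f n) ≤ ∑' n, boxMass P x (f n) ∧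
    (Pairwise (Function.onFun Disjoint f) →
      boxMass P x (⋃ n, f n) = ∑' n, boxMass P x (f n)) := by
  choose s hs hfs using hf
  obtain rfl : f = fun n => Set.univ.pi (s n) := funext hfs
  obtain ⟨t, ht, hut⟩ := hu
  have e : ∀ n, boxMass P x (Set.univ.pi (s n)) = ENNReal.ofReal (‖boxOp P (s n) x‖ ^ 2) :=
    fun n => boxMass_pi (hs n) x
  rw [hut, boxMass_pi ht, tsum_congr e]
  have h1 := box_le_tsum (P := P) ht hs hut.ge x
  exact ⟨h1, fun hd => h1.antisymm (tsum_le_box ht hs hd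
    (fun n => (Set.subset_iUnion (fun n => Set.univ.pi (s n)) n).trans hut.le) x)⟩

variable (P) in
/-- `boxMass` as an additive content on the semiring of boxes. -/
def boxContent [Nonempty ι] (x : HilbertTensor E) :
    MeasureTheory.AddContent ENNReal (boxes Ω) where
  toFun := boxMass P x
  empty' := boxMass_empty x
  sUnion' I hI hd hu := by
    have : Encodable (I : Set (Set (∀ i, Ω i))) := Fintype.toEncodable _
    have hU : (⋃ n, ⋃ b ∈ Encodable.decode₂ (I : Set (Set (∀ i, Ω i))) n, (b : Set (∀ i, Ω i))) =
        ⋃₀ (I : Set (Set (∀ i, Ω i))) := by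
      rw [Encodable.iUnion_decode₂, Set.sUnion_eq_iUnion]
    have hem : (∅ : Set (∀ i, Ω i)) ∈ boxes Ω :=
      ⟨fun _ => ∅, fun _ => .empty, (Set.univ_pi_empty).symm⟩
    have h := (boxMass_tsum (P := P)
      (f := fun n => ⋃ b ∈ Encodable.decode₂ (I : Set (Set (∀ i, Ω i))) n, (b : Set (∀ i, Ω i)))
      (fun n => Encodable.iUnion_decode₂_cases (C := fun R => R ∈ boxes Ω) hem fun b => hI b.2)
      (by rw [hU]; exact hu) x).2
      (Encodable.iUnion_decode₂_disjoint_on fun a b hab => hd a.2 b.2 fun h => hab (Subtype.ext h))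
    rw [hU] at h
    rw [h, tsum_iUnion_decode₂ (boxMass P x) (boxMass_empty x)]
    rw [tsum_fintype]
    exact Finset.sum_coe_sort I (boxMass P x)

variable (P) in
theorem exists_boxMeasure [Nonempty ι] (x : HilbertTensor E) :
    ∃ m : MeasureTheory.Measure (∀ i, Ω i), ∀ t : ∀ i, Set (Ω i), (∀ i, MeasurableSet (t i)) →
      m (Set.univ.pi t) = ENNReal.ofReal (‖boxOp P t x‖ ^ 2) := by
  have hs : (boxContent P x).IsSigmaSubadditive := fun f hf hu => (boxMass_tsum hf hu x).1
  refine ⟨(boxContent P x).measure boxes_semiring boxes_gen.le hs, fun t ht => ?_⟩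
  rw [MeasureTheory.AddContent.measure_eq _ boxes_semiring boxes_gen hs ⟨t, ht, rfl⟩]
  exact boxMass_pi ht x

end box
variable [Nonempty ι]

theorem exists_sum_proj {H : Type*} [NormedAddCommGroup H] [InnerProductSpace ℂ H]
    [CompleteSpace H] (T : ℕ → H →L[ℂ] H) (hT : ∀ n, IsStarProjection (T n))
    (h0 : ∀ n m, n ≠ m → T n * T m = 0) (hs : ∀ x, Summable fun n => ‖T n x‖ ^ 2) :
    ∃ S : H →L[ℂ] H, IsStarProjection S ∧ ∀ x, HasSum (fun n => ‖T n x‖ ^ 2) (‖S x‖ ^ 2) := by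
  have h0' : ∀ n m, n ≠ m → ∀ x, T n (T m x) = 0 := fun n m h x => by
    have := congrArg (fun f : H →L[ℂ] H => f x) (h0 n m h)
    simpa only [mul_apply_eq_comp, zero_apply] using this
  have hin : ∀ n m, n ≠ m → ∀ x y, inner ℂ (T n x) (T m y) = 0 := fun n m h x y => by
    rw [proj_inner (hT n), h0' n m h, inner_zero_right]
  have horth : OrthogonalFamily ℂ (fun n => (T n).range) fun n => (T n).range.subtypeₗᵢ := by
    refine OrthogonalFamily.of_pairwise fun n m h => ?_
    rw [Function.onFun, Submodule.isOrtho_iff_inner_eq]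
    rintro _ ⟨x, rfl⟩ _ ⟨y, rfl⟩
    exact hin n m h x y
  have hsum : ∀ x, Summable fun n => T n x := fun x =>
    (horth.summable_iff_norm_sq_summable fun n => ⟨T n x, ⟨x, rfl⟩⟩).2 (hs x)
  let A : ℕ → H →L[ℂ] H := fun N => ∑ n ∈ Finset.range N, T n
  have hA : ∀ N x, A N x = ∑ n ∈ Finset.range N, T n x := fun N x => by simp [A]
  have hlim : ∀ x, Filter.Tendsto (fun N => A N x) Filter.atTop (nhds (∑' n, T n x)) := fun x => by
    simp only [hA]; exact (hsum x).hasSum.tendsto_sum_nat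
  let S : H →L[ℂ] H := continuousLinearMapOfTendsto A (f := fun x => ∑' n, T n x)
    (tendsto_pi_nhds.2 hlim)
  have hS : ∀ x, HasSum (fun n => T n x) (S x) := fun x => (hsum x).hasSum
  have hTS : ∀ n x, T n (S x) = T n x := by
    intro n x
    have h1 := (T n).hasSum (hS x)
    have h2 : HasSum (fun m => T n (T m x)) (T n (T n x)) :=
      hasSum_single n fun m hm => h0' n m hm.symm x
    rw [h1.unique h2, proj_apply (hT n)]
  refine ⟨S, ⟨?_, ?_⟩, fun x => ?_⟩
  · ext x
    have := hS (S x)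
    simp only [hTS] at this
    exact this.unique (hS x)
  · rw [ContinuousLinearMap.isSelfAdjoint_iff_isSymmetric]
    intro x y
    change inner ℂ (S x) y = inner ℂ x (S y)
    have h1 := (innerSL ℂ x).hasSum (hS y)
    have h2 := (innerSL ℂ y).hasSum (hS x)
    simp only [innerSL_apply_apply] at h1 h2
    rw [← inner_conj_symm, ← h1.tsum_eq, ← h2.tsum_eq, Complex.conj_tsum]
    refine tsum_congr fun n => ?_
    rw [inner_conj_symm, proj_inner (hT n)]
  · have h1 := (innerSL ℂ x).hasSum (hS x)
    simp only [innerSL_apply_apply, proj_inner_self (hT _)] at h1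
    have h2 : inner ℂ x (S x) = ((‖S x‖ ^ 2 : ℝ) : ℂ) := by
      have h3 := (innerSL ℂ (S x)).hasSum (hS x)
      simp only [innerSL_apply_apply] at h3
      have h4 : ∀ n, inner ℂ (S x) (T n x) = ((‖T n x‖ ^ 2 : ℝ) : ℂ) := fun n => by
        rw [← proj_inner (hT n), hTS, proj_inner (hT n), proj_inner_self (hT n)]
      simp only [h4] at h3
      rw [h1.unique h3, inner_self_eq_norm_sq_to_K]
      simp
    rw [h2] at h1
    exact_mod_cast h1

theorem exists_proj_of_measure (m : HilbertTensor E → MeasureTheory.Measure (∀ i, Ω i))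
    (hm : ∀ x, ∀ t : ∀ i, Set (Ω i), (∀ i, MeasurableSet (t i)) →
      m x (Set.univ.pi t) = ENNReal.ofReal (‖boxOp P t x‖ ^ 2))
    (G : Set (∀ i, Ω i)) (hG : MeasurableSet G) :
    ∃ T : HilbertTensor E →L[ℂ] HilbertTensor E, IsStarProjection T ∧
      ∀ x, ENNReal.ofReal (‖T x‖ ^ 2) = m x G := by
  have huniv : ∀ x, m x Set.univ = ENNReal.ofReal (‖x‖ ^ 2) := fun x => by
    have := hm x (fun _ => Set.univ) fun _ => .univ
    rwa [boxOp_univ, Set.pi_univ] at this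
  have hfin : ∀ x, MeasureTheory.IsFiniteMeasure (m x) := fun x =>
    ⟨by rw [huniv]; exact ENNReal.ofReal_lt_top⟩
  induction G, hG using MeasurableSpace.induction_on_inter (boxes_gen (Ω := Ω))
    boxes_semiring.isPiSystem with
  | empty => exact ⟨0, .zero _, fun x => by simp⟩
  | basic R hR =>
    obtain ⟨t, ht, rfl⟩ := hR
    exact ⟨boxOp P t, boxOp_proj ht, fun x => (hm x t ht).symm⟩
  | compl R hR ih =>
    obtain ⟨T, hT, h⟩ := ih
    refine ⟨1 - T, hT.one_sub, fun x => ?_⟩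
    rw [MeasureTheory.measure_compl hR (MeasureTheory.measure_ne_top _ _), huniv, ← h,
      ← ENNReal.ofReal_sub _ (by positivity), ← proj_sq hT]
    rfl
  | iUnion f hd hf ih =>
    choose T hT h using ih
    have h0 : ∀ n k, n ≠ k → T n * T k = 0 := by
      intro n k hnk
      refine proj_mul_eq_zero (hT k) fun x => ?_
      rw [← ENNReal.ofReal_le_ofReal_iff (by positivity),
        ENNReal.ofReal_add (by positivity) (by positivity), h, h,
        ← MeasureTheory.measure_union (hd hnk) (hf k), ← huniv]
      exact MeasureTheory.measure_mono (Set.subset_univ _)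
    have h1 : ∀ x, m x (⋃ n, f n) = ∑' n, ENNReal.ofReal (‖T n x‖ ^ 2) := fun x => by
      simp only [h]
      exact MeasureTheory.measure_iUnion hd hf
    have h2 : ∀ x, Summable fun n => ‖T n x‖ ^ 2 := fun x => by
      have := ENNReal.summable_toReal (f := fun n => ENNReal.ofReal (‖T n x‖ ^ 2))
        (by rw [← h1]; exact MeasureTheory.measure_ne_top _ _)
      simpa only [ENNReal.toReal_ofReal (sq_nonneg _)] using this
    obtain ⟨S, hS, hSs⟩ := exists_sum_proj T hT h0 h2
    refine ⟨S, hS, fun x => ?_⟩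
    rw [h1, ← (hSs x).tsum_eq, ENNReal.ofReal_tsum_of_nonneg (fun _ => by positivity) (h2 x)]

/-- Existence of the tensor product of projection-valued measures. -/
theorem exists_tensorPVM : ∃ Q : ProjectionValuedMeasure (∀ i, Ω i) (HilbertTensor E),
    ∀ G : ∀ i, Set (Ω i), (∀ i, MeasurableSet (G i)) → ∀ h : ∀ i, E i,
      Q (Set.univ.pi G) (hTprod h) = hTprod fun i => P i (G i) (h i) := by
  classical
  choose m hm using exists_boxMeasure P
  choose! T hT hTm using exists_proj_of_measure P m hm
  have hbox : ∀ t : ∀ i, Set (Ω i), (∀ i, MeasurableSet (t i)) →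
      T (Set.univ.pi t) = boxOp P t := fun t ht => by
    refine proj_ext (hT _ (MeasurableSet.univ_pi ht)) (boxOp_proj ht) fun x => ?_
    have := hTm _ (MeasurableSet.univ_pi ht) x
    rw [hm x t ht] at this
    exact (ENNReal.ofReal_eq_ofReal_iff (by positivity) (by positivity)).1 this
  refine ⟨⟨T, ?_, hT, ?_⟩, fun G hG h => ?_⟩
  · have := hbox (fun _ => Set.univ) fun _ => .univ
    rwa [boxOp_univ, Set.pi_univ] at this
  · intro G hG hd x y
    have key : ∀ z, HasSum (fun n => inner ℂ (T (G n) z) z) (inner ℂ (T (⋃ n, G n) z) z) := by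
      intro z
      have e : ∀ R, MeasurableSet R → inner ℂ (T R z) z = (((m z R).toReal : ℝ) : ℂ) := by
        intro R hR
        rw [proj_inner (hT R hR), proj_inner_self (hT R hR), ← hTm R hR z,
          ENNReal.toReal_ofReal (by positivity)]
      simp only [e _ (hG _), e _ (MeasurableSet.iUnion hG)]
      rw [Complex.hasSum_ofReal]
      rw [MeasureTheory.measure_iUnion hd hG]
      have hfin : ∑' n, m z (G n) ≠ ⊤ := by
        rw [← MeasureTheory.measure_iUnion hd hG, ← hTm _ (MeasurableSet.iUnion hG) z]
        exact ENNReal.ofReal_ne_top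
      rw [ENNReal.tsum_toReal_eq fun n => ENNReal.ne_top_of_tsum_ne_top hfin n]
      exact ENNReal.hasSum_toReal hfin
    have e : ∀ R, MeasurableSet R → inner ℂ y (T R x) =
        (inner ℂ (T R (x + y)) (x + y) - inner ℂ (T R (x - y)) (x - y) +
          Complex.I * inner ℂ (T R (x + Complex.I • y)) (x + Complex.I • y) -
          Complex.I * inner ℂ (T R (x - Complex.I • y)) (x - Complex.I • y)) / 4 := by
      intro R hR
      rw [← proj_inner (hT R hR)]
      exact inner_map_polarization (T R).toLinearMap x y
    simp only [e _ (hG _), e _ (MeasurableSet.iUnion hG)]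
    exact ((((key _).sub (key _)).add ((key _).mul_left _)).sub ((key _).mul_left _)).div_const _
  · change T _ _ = _
    rw [hbox G hG, boxOp_hTprod hG]

/-- A projection-valued measure on the product is determined by its values on boxes, tested on pure
tensors. -/
theorem pvm_ext {Q R : ProjectionValuedMeasure (∀ i, Ω i) (HilbertTensor E)}
    (h : ∀ t : ∀ i, Set (Ω i), (∀ i, MeasurableSet (t i)) → ∀ k : ∀ i, E i,
      Q (Set.univ.pi t) (hTprod k) = R (Set.univ.pi t) (hTprod k))
    {G : Set (∀ i, Ω i)} (hG : MeasurableSet G) : Q G = R G := by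
  have hd : ∀ x, Q.diag x = R.diag x := fun x => by
    refine MeasureTheory.ext_of_generate_finite _ (boxes_gen (Ω := Ω))
      boxes_semiring.isPiSystem ?_ ?_
    · rintro _ ⟨t, ht, rfl⟩
      rw [Q.diag_apply _ (.univ_pi ht), R.diag_apply _ (.univ_pi ht),
        hilbertTensor_ext (h t ht)]
    · rw [Q.diag_apply _ .univ, R.diag_apply _ .univ, Q.univ', R.univ']
  refine proj_ext (Q.isStarProjection' _ hG) (R.isStarProjection' _ hG) fun x => ?_
  have := congrArg (fun m => m G) (hd x)
  simp only [Q.diag_apply _ hG, R.diag_apply _ hG] at this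
  exact (ENNReal.ofReal_eq_ofReal_iff (by positivity) (by positivity)).1 this

/-- The tensor product `P = ⊗ᵢ P i`: the unique projection-valued measure on `∏ᵢ Ω i` (with the product
σ-algebra) and the Hilbert space tensor product with
`P (∏ᵢ G i) (⊗ᵢ h i) = ⊗ᵢ P i (G i) (h i)` for all measurable `G i` and all `h i`; see `tensorPVM_pi`
for this property and `pvm_ext` for uniqueness. -/
def tensorPVM : ProjectionValuedMeasure (∀ i, Ω i) (HilbertTensor E) :=
  (exists_tensorPVM P).choose

theorem tensorPVM_pi (G : ∀ i, Set (Ω i)) (hG : ∀ i, MeasurableSet (G i)) (h : ∀ i, E i) :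
    tensorPVM P (Set.univ.pi G) (hTprod h) = hTprod fun i => P i (G i) (h i) :=
  (exists_tensorPVM P).choose_spec G hG h

end TensorPVM

section Linfty

open scoped ENNReal

variable {Ω : Type*} [MeasurableSpace Ω] {H : Type*} [NormedAddCommGroup H]
  [InnerProductSpace ℂ H] [CompleteSpace H]

variable (Ω) in
/-- `ℓ^∞(Ω, F)`: the *-algebra of bounded measurable functions `Ω → ℂ`. -/
def ellInfty : StarSubalgebra ℂ (Ω → ℂ) where
  carrier := {f | Measurable f ∧ ∃ C : ℝ, ∀ ω, ‖f ω‖ ≤ C}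
  mul_mem' := by
    rintro f g ⟨hf, C, hC⟩ ⟨hg, D, hD⟩
    refine ⟨hf.mul hg, C * D, fun ω => ?_⟩
    rw [Pi.mul_apply, norm_mul]
    exact mul_le_mul (hC ω) (hD ω) (norm_nonneg _) ((norm_nonneg _).trans (hC ω))
  add_mem' := by
    rintro f g ⟨hf, C, hC⟩ ⟨hg, D, hD⟩
    exact ⟨hf.add hg, C + D, fun ω => (norm_add_le _ _).trans (add_le_add (hC ω) (hD ω))⟩
  algebraMap_mem' c := ⟨measurable_const, ‖c‖, fun _ => le_rfl⟩
  star_mem' := by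
    rintro f ⟨hf, C, hC⟩
    exact ⟨Complex.continuous_conj.measurable.comp hf, C, fun ω => by rw [Pi.star_apply, norm_star]; exact hC ω⟩

instance : CommRing (ellInfty Ω) := inferInstance

variable (P : ProjectionValuedMeasure Ω H)

/-- The bounded measurable functions that vanish `P`-almost everywhere. -/
def nullIdeal : Ideal (ellInfty Ω) where
  carrier := {f | ∀ᶠ ω in P.ae, (f : Ω → ℂ) ω = 0}
  add_mem' := by
    intro f g hf hg
    change ∀ᶠ ω in P.ae, (f : Ω → ℂ) ω + (g : Ω → ℂ) ω = 0
    filter_upwards [hf, hg] with ω h1 h2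
    rw [h1, h2, add_zero]
  zero_mem' := by simp
  smul_mem' := by
    intro c f hf
    change ∀ᶠ ω in P.ae, (c : Ω → ℂ) ω * (f : Ω → ℂ) ω = 0
    filter_upwards [hf] with ω h
    rw [h, mul_zero]

/-- `L^∞(Ω, P)`: bounded measurable functions modulo equality `P`-almost everywhere, with the quotient
*-algebra structure. -/
abbrev Linfty : Type _ := ellInfty Ω ⧸ nullIdeal P

theorem ae_eq_of_mk_eq {f g : ellInfty Ω}
    (h : (Ideal.Quotient.mk (nullIdeal P) f) = Ideal.Quotient.mk (nullIdeal P) g) :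
    (f : Ω → ℂ) =ᶠ[P.ae] g := by
  have h : f - g ∈ nullIdeal P := Ideal.Quotient.eq.1 h
  filter_upwards [h] with ω hω
  exact sub_eq_zero.1 hω

/-- Complex conjugation on `L^∞(Ω, P)`. -/
def Linfty.starHom : Linfty P →+* Linfty P :=
  Ideal.quotientMap (nullIdeal P) (starRingEnd (ellInfty Ω)) (by
    intro f hf
    change ∀ᶠ ω in P.ae, star ((f : Ω → ℂ) ω) = 0
    filter_upwards [hf] with ω h
    rw [h, star_zero])

instance : StarRing (Linfty P) where
  star := Linfty.starHom P
  star_involutive x := by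
    obtain ⟨f, rfl⟩ := Ideal.Quotient.mk_surjective x
    change Ideal.Quotient.mk _ (star (star f)) = _
    rw [star_star]
  star_mul x y := by
    change Linfty.starHom P (x * y) = Linfty.starHom P y * Linfty.starHom P x
    rw [map_mul, mul_comm]
  star_add x y := map_add (Linfty.starHom P) x y

theorem Linfty.star_mk (f : ellInfty Ω) :
    star (Ideal.Quotient.mk (nullIdeal P) f) = Ideal.Quotient.mk (nullIdeal P) (star f) := rfl

instance : StarModule ℂ (Linfty P) where
  star_smul c x := by
    obtain ⟨f, rfl⟩ := Ideal.Quotient.mk_surjective x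
    change Ideal.Quotient.mk (nullIdeal P) (star (c • f)) =
      Ideal.Quotient.mk (nullIdeal P) (star c • star f)
    rw [star_smul]

/-- The `P`-essential supremum of `|f|`, in `[0, ∞]`; for measurable `f` it is
`inf {c ≥ 0 | P {ω | |f ω| > c} = 0}`, see `essSupNorm_eq`. -/
def essSupNorm (f : Ω → ℂ) : ℝ≥0∞ := sInf {c : ℝ≥0∞ | ∀ᶠ ω in P.ae, ‖f ω‖ₑ ≤ c}

theorem essSupNorm_congr {f g : Ω → ℂ} (h : f =ᶠ[P.ae] g) :
    essSupNorm P f = essSupNorm P g := by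
  unfold essSupNorm
  congr 1
  ext c
  exact Filter.eventually_congr (h.mono fun ω h1 => by rw [h1])

theorem essSupNorm_eq {f : Ω → ℂ} (hf : Measurable f) :
    essSupNorm P f = sInf {c : ℝ≥0∞ | P {ω | c < ‖f ω‖ₑ} = 0} := by
  unfold essSupNorm
  congr 1
  ext c
  have hm : MeasurableSet {ω | c < ‖f ω‖ₑ} := measurableSet_lt measurable_const hf.enorm
  have hc : {ω | ‖f ω‖ₑ ≤ c}ᶜ = {ω | c < ‖f ω‖ₑ} := by ext ω; simp
  constructor
  · rintro ⟨N, hN, h0, hs⟩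
    have hsub : {ω | c < ‖f ω‖ₑ} ⊆ N := hc.symm.subset.trans hs
    rw [P.eq_zero_iff hN] at h0
    exact (P.eq_zero_iff hm).2 fun x => MeasureTheory.measure_mono_null hsub (h0 x)
  · intro h
    exact ⟨_, hm, h, hc.subset⟩

/-- The norm of `L^∞(Ω, P)`, with values in `[0, ∞]`. -/
def Linfty.norm (x : Linfty P) : ℝ≥0∞ :=
  Quotient.liftOn' x (fun f => essSupNorm P (f : Ω → ℂ)) fun _ _ h =>
    essSupNorm_congr P (ae_eq_of_mk_eq P (Quotient.sound' h))

theorem Linfty.norm_mk (f : ellInfty Ω) :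
    Linfty.norm P (Ideal.Quotient.mk (nullIdeal P) f) = essSupNorm P (f : Ω → ℂ) := rfl

end Linfty

section IPTP

open scoped ENNReal

/-- The upper integral of an arbitrary function `h : S → [0, ∞]`. -/
def upperIntegral {S : Type*} [MeasurableSpace S] (ρ : MeasureTheory.Measure S)
    (h : S → ℝ≥0∞) : ℝ≥0∞ :=
  sInf {c : ℝ≥0∞ | ∃ g : S → ℝ≥0∞, Measurable g ∧ (∀ᵐ σ ∂ρ, h σ ≤ g σ) ∧ c = ∫⁻ σ, g σ ∂ρ}

variable {ι : Type*} [Fintype ι] [Nonempty ι] {Ω : ι → Type*} [∀ i, MeasurableSpace (Ω i)]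
  {E : ι → Type*} [∀ i, NormedAddCommGroup (E i)] [∀ i, InnerProductSpace ℂ (E i)]
  [∀ i, CompleteSpace (E i)] (P : ∀ i, ProjectionValuedMeasure (Ω i) (E i))

/-- An `L^∞_P`-integral projective decomposition of a function `φ : ∏ᵢ Ω i → ℂ`, where `P = ⊗ᵢ P i`: a
σ-finite measure space `(S, ρ)` and measurable functions `f i : Ω i × S → ℂ` with
`f i (·, σ) ∈ L^∞(Ω i, P i)` for all `σ`, with
`upper-∫ ∏ᵢ ‖f i (·, σ)‖_{L^∞(P i)} ρ(dσ) < ∞`, and with `φ ω = ∫ ∏ᵢ f i (ω i, σ) ρ(dσ)` for `P`-almost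
every `ω`. (The integrand of the last integral is `ρ`-integrable for `P`-almost every `ω` as a
consequence of the bound on the upper integral.) -/
structure IPD (φ : (∀ i, Ω i) → ℂ) where
  S : Type w
  mS : MeasurableSpace S
  ρ : MeasureTheory.Measure S
  sigmaFinite : MeasureTheory.SigmaFinite ρ
  f : ∀ i, Ω i × S → ℂ
  measurable : ∀ i, Measurable (f i)
  mem_Linfty : ∀ i σ, essSupNorm (P i) (fun ω => f i (ω, σ)) < ∞
  lt_top : upperIntegral ρ (fun σ => ∏ i, essSupNorm (P i) fun ω => f i (ω, σ)) < ∞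
  eq_integral : ∀ᶠ ω in (tensorPVM P).ae, φ ω = ∫ σ, ∏ i, f i (ω i, σ) ∂ρ

variable {P} in
/-- The number `upper-∫ ∏ᵢ ‖f i (·, σ)‖_{L^∞(P i)} ρ(dσ)` of a decomposition. -/
def IPD.cost {φ : (∀ i, Ω i) → ℂ} (D : IPD.{w} P φ) : ℝ≥0∞ :=
  letI := D.mS
  upperIntegral D.ρ fun σ => ∏ i, essSupNorm (P i) fun ω => D.f i (ω, σ)

/-- The infimum of the costs of all integral projective decompositions of `φ`, with `inf ∅ = ∞`. -/
def iptpNormFun (φ : (∀ i, Ω i) → ℂ) : ℝ≥0∞ := ⨅ D : IPD.{w} P φ, D.cost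

theorem iptpNormFun_congr {φ ψ : (∀ i, Ω i) → ℂ} (h : φ =ᶠ[(tensorPVM P).ae] ψ) :
    iptpNormFun.{w} P φ = iptpNormFun.{w} P ψ := by
  have key : ∀ {φ ψ : (∀ i, Ω i) → ℂ}, φ =ᶠ[(tensorPVM P).ae] ψ →
      iptpNormFun.{w} P φ ≤ iptpNormFun.{w} P ψ := by
    intro φ ψ h
    refine le_iInf fun D => ?_
    let D' : IPD.{w} P φ := { D with
      eq_integral := by
        filter_upwards [h, D.eq_integral] with ω h1 h2
        rw [h1, h2] }
    exact iInf_le (fun D : IPD.{w} P φ => D.cost) D'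
  exact le_antisymm (key h) (key h.symm)

/-- The IPTP norm on `L^∞(∏ᵢ Ω i, P)`, with values in `[0, ∞]`. -/
def iptpNorm (x : Linfty (tensorPVM P)) : ℝ≥0∞ :=
  Quotient.liftOn' x (fun φ => iptpNormFun.{w} P (φ : (∀ i, Ω i) → ℂ)) fun _ _ h =>
    iptpNormFun_congr P (ae_eq_of_mk_eq (tensorPVM P) (Quotient.sound' h))

/-- The integral projective tensor product of the `L^∞(Ω i, P i)`. -/
def iptp : Set (Linfty (tensorPVM P)) := {x | iptpNorm.{w} P x < ∞}

end IPTP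

/-- The unital *-algebra `A` is a Banach *-algebra with the norm `N`: `N` is a complete submultiplicative
norm, the unit has norm `1` (unless `A` is the zero algebra), and the *-operation is isometric. -/
structure IsBanachStarAlgebraNorm (A : Type*) [Ring A] [Algebra ℂ A] [StarRing A]
    [StarModule ℂ A] (N : A → ℝ) : Prop where
  nonneg : ∀ a, 0 ≤ N a
  eq_zero_iff : ∀ a, N a = 0 ↔ a = 0
  add_le : ∀ a b, N (a + b) ≤ N a + N b
  smul : ∀ (c : ℂ) a, N (c • a) = ‖c‖ * N a
  mul_le : ∀ a b, N (a * b) ≤ N a * N b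
  norm_one : Nontrivial A → N 1 = 1
  norm_star : ∀ a, N (star a) = N a
  complete : ∀ u : ℕ → A, (∀ ε > 0, ∃ n₀, ∀ m ≥ n₀, ∀ n ≥ n₀, N (u m - u n) < ε) →
    ∃ a, Filter.Tendsto (fun n => N (u n - a)) Filter.atTop (nhds 0)

end IPTP

end

open IPTP

/-! The norm bound rests on one estimate for decompositions. A cylinder over a `P i`-null set is
null for the tensor product measure, so for each `σ` the product `∏ i, f i (ω i, σ)` is bounded by
the product of the essential suprema for almost every `ω`. Tonelli, applied to `ρ` and each scalar
measure `diag x`, moves the exceptional set from `ω` for fixed `σ` to `σ` for fixed `ω`. Hence the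
integrand is dominated, for almost every `ω`, by any measurable majorant `g` of the possibly
nonmeasurable product of essential suprema (`lintegral_enorm_prod_le`). This gives `|φ| ≤ ∫ g`
almost everywhere, so the IPTP norm dominates the `L^∞` norm, and in particular it is definite.

The algebra operations come from constructions on parameter spaces. Products use the product of two
spaces (`iptpNormFun_mul_le`), conjugation keeps the space and conjugates the factors
(`iptpNormFun_star_le`), and constants live on a one-point space (`iptpNormFun_const_le`).

The main construction is the disjoint union of countably many parameter spaces. It shows that the
norm is countably subadditive along series that represent a function almost everywhere
(`iptpNormFun_le_tsum`). Two nonzero terms give the triangle inequality. The full strength gives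
completeness: an absolutely convergent series has, by the `L^∞` bound, representatives that sum
absolutely at every point, and the remainder of their sum is controlled by the tails of the series
of norms (`exists_iptpNorm_sub_sum_le`). -/

namespace IPTP

open scoped ENNReal

open MeasureTheory Filter

/-! ### Null sets of a projection-valued measure. -/

namespace ProjectionValuedMeasure

variable {H : Type*} [NormedAddCommGroup H] [InnerProductSpace ℂ H] [CompleteSpace H]
  {Ω : Type*} [MeasurableSpace Ω] (P : ProjectionValuedMeasure Ω H)

/-- The Hilbert space may be nonseparable, but no uncountable union of null sets occurs: the single
measurable set `sᶜ` is tested against every scalar measure. This is how Fubini, available for each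
`diag x`, yields statements about `P`. -/
theorem mem_ae_of_diag {s : Set Ω} (hs : MeasurableSet s) (h : ∀ x, ∀ᵐ ω ∂P.diag x, ω ∈ s) :
    s ∈ P.ae :=
  ⟨sᶜ, hs.compl, (P.eq_zero_iff hs.compl).2 h, le_rfl⟩

/-- Inherited from the scalar measures `diag x`. It is needed for attaining the essential supremum
and for using countably many decompositions at once. -/
instance : CountableInterFilter P.ae where
  countable_sInter_mem S hS h := by
    choose! N hN h0 hsub using h
    refine ⟨⋃ s ∈ S, N s, .biUnion hS hN, ?_, ?_⟩
    · rw [P.eq_zero_iff (.biUnion hS hN)]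
      exact fun x => (measure_biUnion_null_iff hS).2 fun s hs =>
        (P.eq_zero_iff (hN s hs)).1 (h0 s hs) x
    · rw [Set.compl_sInter, Set.sUnion_image]
      exact Set.biUnion_mono subset_rfl hsub

end ProjectionValuedMeasure

/-! ### The essential supremum and the norm of `L^∞`. -/

section essSup

variable {Ω : Type*} [MeasurableSpace Ω] {H : Type*} [NormedAddCommGroup H]
  [InnerProductSpace ℂ H] [CompleteSpace H] (P : ProjectionValuedMeasure Ω H)

/-- The infimum is attained: a sequence of essential bounds tends to it, and countably many
exceptional sets can be discarded together. -/
theorem enorm_le_essSupNorm (f : Ω → ℂ) : ∀ᶠ ω in P.ae, ‖f ω‖ₑ ≤ essSupNorm P f := by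
  have hne : {c : ℝ≥0∞ | ∀ᶠ ω in P.ae, ‖f ω‖ₑ ≤ c}.Nonempty := ⟨∞, by simp⟩
  obtain ⟨u, -, hu, hmem⟩ := exists_seq_tendsto_sInf hne (OrderBot.bddBelow _)
  filter_upwards [eventually_countable_forall.2 hmem] with ω hω
  exact ge_of_tendsto' hu hω

theorem essSupNorm_le {f : Ω → ℂ} {c : ℝ≥0∞} (h : ∀ᶠ ω in P.ae, ‖f ω‖ₑ ≤ c) :
    essSupNorm P f ≤ c := sInf_le h

theorem essSupNorm_mul_le (f g : Ω → ℂ) :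
    essSupNorm P (fun ω => f ω * g ω) ≤ essSupNorm P f * essSupNorm P g := by
  refine essSupNorm_le P ?_
  filter_upwards [enorm_le_essSupNorm P f, enorm_le_essSupNorm P g] with ω h1 h2
  rw [enorm_mul]
  gcongr

theorem essSupNorm_star (f : Ω → ℂ) :
    essSupNorm P (fun ω => starRingEnd ℂ (f ω)) = essSupNorm P f := by
  simp [essSupNorm]

theorem essSupNorm_const_le (c : ℂ) : essSupNorm P (fun _ => c) ≤ ‖c‖ₑ :=
  essSupNorm_le P (Eventually.of_forall fun _ => le_rfl)

theorem Linfty.eq_zero_of_norm_eq_zero {x : Linfty P} (h : Linfty.norm P x = 0) : x = 0 := by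
  obtain ⟨f, rfl⟩ := Ideal.Quotient.mk_surjective x
  rw [Linfty.norm_mk] at h
  refine Ideal.Quotient.eq_zero_iff_mem.2 ?_
  change ∀ᶠ ω in P.ae, (f : Ω → ℂ) ω = 0
  filter_upwards [enorm_le_essSupNorm P f] with ω hω
  simpa [h] using hω

/-- A class of finite norm has a representative that is bounded by its norm everywhere. -/
theorem Linfty.exists_rep (x : Linfty P) {c : ℝ} (hc : 0 ≤ c)
    (h : Linfty.norm P x ≤ ENNReal.ofReal c) :
    ∃ f : ellInfty Ω, Ideal.Quotient.mk (nullIdeal P) f = x ∧ ∀ ω, ‖(f : Ω → ℂ) ω‖ ≤ c := by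
  obtain ⟨f, rfl⟩ := Ideal.Quotient.mk_surjective x
  rw [Linfty.norm_mk] at h
  have hs : MeasurableSet {ω | ‖(f : Ω → ℂ) ω‖ ≤ c} :=
    measurableSet_le f.2.1.norm measurable_const
  have hb : ∀ ω, ‖Set.indicator {ω | ‖(f : Ω → ℂ) ω‖ ≤ c} (f : Ω → ℂ) ω‖ ≤ c := by
    intro ω
    by_cases hω : ω ∈ {ω | ‖(f : Ω → ℂ) ω‖ ≤ c}
    · rw [Set.indicator_of_mem hω]; exact hω
    · rw [Set.indicator_of_notMem hω, norm_zero]; exact hc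
  -- Values of modulus above `c` are replaced by `0`, which changes `f` only on a null set.
  refine ⟨⟨Set.indicator {ω | ‖(f : Ω → ℂ) ω‖ ≤ c} f, f.2.1.indicator hs, c, hb⟩, ?_, hb⟩
  refine Ideal.Quotient.eq.2 ?_
  change ∀ᶠ ω in P.ae, Set.indicator {ω | ‖(f : Ω → ℂ) ω‖ ≤ c} (f : Ω → ℂ) ω - (f : Ω → ℂ) ω = 0
  filter_upwards [enorm_le_essSupNorm P f] with ω hω
  have h1 : ω ∈ {ω | ‖(f : Ω → ℂ) ω‖ ≤ c} := by
    have := hω.trans h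
    rwa [← ofReal_norm, ENNReal.ofReal_le_ofReal_iff hc] at this
  rw [Set.indicator_of_mem h1, sub_self]

end essSup

/-! ### Pointwise domination of integral projective decompositions. -/

section decomposition

variable {ι : Type*} [Fintype ι] [Nonempty ι] {Ω : ι → Type*} [∀ i, MeasurableSpace (Ω i)]
  {E : ι → Type*} [∀ i, NormedAddCommGroup (E i)] [∀ i, InnerProductSpace ℂ (E i)]
  [∀ i, CompleteSpace (E i)] (P : ∀ i, ProjectionValuedMeasure (Ω i) (E i))

/-- The cylinder over a `P i`-null set `N` is a box with full factors elsewhere. Its projection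
sends every pure tensor to one with a zero factor, and an operator that kills the pure tensors
vanishes by `hilbertTensor_ext`. -/
theorem tendsto_eval_tensorPVM_ae (i : ι) :
    Tendsto (Function.eval i) (tensorPVM P).ae (P i).ae := by
  classical
  rintro s ⟨N, hN, h0, hs⟩
  have he : Function.eval i ⁻¹' N =
      Set.univ.pi (Function.update (fun j => (Set.univ : Set (Ω j))) i N) := by
    ext ω
    simp only [Set.mem_preimage, Set.mem_univ_pi]
    refine ⟨fun h j => ?_, fun h => by simpa using h i⟩
    rcases eq_or_ne j i with rfl | hj
    · simpa using h
    · simp [hj]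
  refine ⟨Function.eval i ⁻¹' N, measurable_pi_apply i hN, ?_, Set.preimage_mono hs⟩
  rw [he]
  refine hilbertTensor_ext fun k => ?_
  rw [tensorPVM_pi, zero_apply, ← norm_eq_zero, ← sq_eq_zero_iff, norm_hTprod]
  · exact Finset.prod_eq_zero (Finset.mem_univ i) (by simp [h0])
  · intro j
    rcases eq_or_ne j i with rfl | hj
    · simpa using hN
    · simp [hj]

theorem enorm_prod_le_prod_essSupNorm (f : ∀ i, Ω i → ℂ) :
    ∀ᶠ ω in (tensorPVM P).ae, ‖∏ i, f i (ω i)‖ₑ ≤ ∏ i, essSupNorm (P i) (f i) := by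
  have h : ∀ᶠ ω in (tensorPVM P).ae, ∀ i, ‖f i (ω i)‖ₑ ≤ essSupNorm (P i) (f i) :=
    eventually_all.2 fun i =>
      (tendsto_eval_tensorPVM_ae P i).eventually (enorm_le_essSupNorm (P i) (f i))
  filter_upwards [h] with ω hω
  rw [← ofReal_norm, norm_prod, ENNReal.ofReal_prod_of_nonneg fun _ _ => norm_nonneg _]
  simp only [ofReal_norm]
  exact Finset.prod_le_prod' fun i _ => hω i

theorem measurable_prod_comp {S : Type*} [MeasurableSpace S] {f : ∀ i, Ω i × S → ℂ}
    (hf : ∀ i, Measurable (f i)) :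
    Measurable fun z : (∀ i, Ω i) × S => ∏ i, f i (z.1 i, z.2) :=
  Finset.measurable_prod _ fun i _ =>
    (hf i).comp (((measurable_pi_apply i).comp measurable_fst).prodMk measurable_snd)

/-- The essential bound holds for almost every `ω` with an exceptional set depending on `σ`; Tonelli
exchanges the two quantifiers. The majorant `g` is there because `σ ↦ ∏ i, essSupNorm ..` need not
be measurable. -/
theorem lintegral_enorm_prod_le {S : Type*} [MeasurableSpace S] {ρ : Measure S} [SFinite ρ]
    {f : ∀ i, Ω i × S → ℂ} (hf : ∀ i, Measurable (f i)) {g : S → ℝ≥0∞} (hg : Measurable g)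
    (hfg : ∀ᵐ σ ∂ρ, ∏ i, essSupNorm (P i) (fun ω => f i (ω, σ)) ≤ g σ) :
    ∀ᶠ ω in (tensorPVM P).ae, ∫⁻ σ, ‖∏ i, f i (ω i, σ)‖ₑ ∂ρ ≤ ∫⁻ σ, g σ ∂ρ := by
  have hm := (measurable_prod_comp hf).enorm
  -- The set of good `ω` is measurable by Tonelli, so one scalar measure `diag x` at a time
  -- suffices.
  refine (tensorPVM P).mem_ae_of_diag
    (measurableSet_le hm.lintegral_prod_right' measurable_const) fun x => ?_
  have h1 : ∀ᵐ σ ∂ρ, ∀ᵐ ω ∂(tensorPVM P).diag x, ‖∏ i, f i (ω i, σ)‖ₑ ≤ g σ := by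
    filter_upwards [hfg] with σ hσ
    obtain ⟨N, hN, h0, hs⟩ := enorm_prod_le_prod_essSupNorm P fun i ω => f i (ω, σ)
    rw [(tensorPVM P).eq_zero_iff hN] at h0
    refine measure_mono_null (fun ω hω => hs fun h => hω ?_) (h0 x)
    exact le_trans h hσ
  -- The exchange requires the set of pairs to be measurable, and this is where measurability of `g`
  -- enters.
  have h2 := (Measure.ae_ae_comm (μ := ρ) (ν := (tensorPVM P).diag x)
    (p := fun σ ω => ‖∏ i, f i (ω i, σ)‖ₑ ≤ g σ)
    (measurableSet_le (hm.comp measurable_swap) (hg.comp measurable_fst))).1 h1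
  filter_upwards [h2] with ω hω
  exact lintegral_mono_ae hω

/-! ### The IPTP norm of functions: products, conjugates and constants. -/

variable {P}

attribute [instance] IPD.mS IPD.sigmaFinite

/-- With `exists_ipd_dominated`, this trades the upper integral for ordinary integrals of measurable
majorants. No finiteness of `∫⁻ g` is asked for, since the bound is empty when it is infinite. -/
theorem iptpNormFun_le_lintegral {φ : (∀ i, Ω i) → ℂ} {S : Type w} [mS : MeasurableSpace S]
    {ρ : Measure S} [hρ : SigmaFinite ρ] {f : ∀ i, Ω i × S → ℂ} (hf : ∀ i, Measurable (f i))
    (hfin : ∀ i σ, essSupNorm (P i) (fun ω => f i (ω, σ)) < ∞) {g : S → ℝ≥0∞}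
    (hg : Measurable g) (hfg : ∀ᵐ σ ∂ρ, ∏ i, essSupNorm (P i) (fun ω => f i (ω, σ)) ≤ g σ)
    (hφ : ∀ᶠ ω in (tensorPVM P).ae, φ ω = ∫ σ, ∏ i, f i (ω i, σ) ∂ρ) :
    iptpNormFun.{w} P φ ≤ ∫⁻ σ, g σ ∂ρ := by
  rcases eq_top_or_lt_top (∫⁻ σ, g σ ∂ρ) with h | h
  · rw [h]; exact le_top
  have hle : upperIntegral ρ (fun σ => ∏ i, essSupNorm (P i) fun ω => f i (ω, σ)) ≤
      ∫⁻ σ, g σ ∂ρ := sInf_le ⟨g, hg, hfg, rfl⟩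
  exact (iInf_le (fun D : IPD.{w} P φ => D.cost)
    ⟨S, mS, ρ, hρ, f, hf, hfin, hle.trans_lt h, hφ⟩).trans hle

theorem exists_ipd_dominated {φ : (∀ i, Ω i) → ℂ} {c : ℝ≥0∞} (h : iptpNormFun.{w} P φ < c) :
    ∃ (D : IPD.{w} P φ) (g : D.S → ℝ≥0∞), Measurable g ∧
      (∀ᵐ σ ∂D.ρ, ∏ i, essSupNorm (P i) (fun ω => D.f i (ω, σ)) ≤ g σ) ∧ ∫⁻ σ, g σ ∂D.ρ < c := by
  obtain ⟨D, hD⟩ := iInf_lt_iff.1 h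
  obtain ⟨_, ⟨g, hg, hfg, rfl⟩, hlt⟩ := sInf_lt_iff.1 hD
  exact ⟨D, g, hg, hfg, hlt⟩

theorem essSupNorm_le_iptpNormFun (φ : (∀ i, Ω i) → ℂ) :
    essSupNorm (tensorPVM P) φ ≤ iptpNormFun.{w} P φ := by
  refine le_of_forall_gt fun c hc => ?_
  obtain ⟨D, g, hg, hfg, hlt⟩ := exists_ipd_dominated hc
  refine lt_of_le_of_lt (essSupNorm_le _ ?_) hlt
  filter_upwards [D.eq_integral, lintegral_enorm_prod_le P D.measurable hg hfg] with ω h1 h2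
  rw [h1]
  exact (enorm_integral_le_lintegral_enorm _).trans h2

/-- Decompositions multiply over the product parameter space: essential suprema are
submultiplicative, and the majorant `g ⊗ g'` has integral `∫ g * ∫ g'`. -/
theorem iptpNormFun_mul_le {φ ψ : (∀ i, Ω i) → ℂ} (hφ : iptpNormFun.{w} P φ < ∞)
    (hψ : iptpNormFun.{w} P ψ < ∞) :
    iptpNormFun.{w} P (φ * ψ) ≤ iptpNormFun.{w} P φ * iptpNormFun.{w} P ψ := by
  -- Finiteness excludes the product `0 * ∞`, so strictly larger `a` and `b` may be used.
  refine ENNReal.le_mul_of_forall_lt (.inr hψ.ne) (.inl hφ.ne) fun a ha b hb => ?_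
  obtain ⟨D, g, hg, hfg, hlt⟩ := exists_ipd_dominated ha
  obtain ⟨D', g', hg', hfg', hlt'⟩ := exists_ipd_dominated hb
  refine le_trans ?_ (mul_le_mul' hlt.le hlt'.le)
  rw [← lintegral_prod_mul hg.aemeasurable hg'.aemeasurable]
  refine iptpNormFun_le_lintegral
    (f := fun i z => D.f i (z.1, z.2.1) * D'.f i (z.1, z.2.2)) (fun i => ?_) (fun i σ => ?_)
    ((hg.comp measurable_fst).mul (hg'.comp measurable_snd)) ?_ ?_
  · exact ((D.measurable i).comp
      (measurable_fst.prodMk (measurable_fst.comp measurable_snd))).mul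
      ((D'.measurable i).comp (measurable_fst.prodMk (measurable_snd.comp measurable_snd)))
  · exact (essSupNorm_mul_le (P i) _ _).trans_lt
      (ENNReal.mul_lt_top (D.mem_Linfty i σ.1) (D'.mem_Linfty i σ.2))
  · filter_upwards [Measure.quasiMeasurePreserving_fst.ae hfg,
      Measure.quasiMeasurePreserving_snd.ae hfg'] with σ h1 h2
    refine le_trans (Finset.prod_le_prod' fun i _ => essSupNorm_mul_le (P i) _ _) ?_
    rw [Finset.prod_mul_distrib]
    exact mul_le_mul' h1 h2
  · filter_upwards [D.eq_integral, D'.eq_integral] with ω h1 h2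
    simp only [Finset.prod_mul_distrib]
    -- The integral of a product of functions of separate variables factors without any
    -- integrability condition.
    rw [integral_prod_mul (fun σ => ∏ i, D.f i (ω i, σ)) fun σ => ∏ i, D'.f i (ω i, σ),
      Pi.mul_apply, h1, h2]

theorem iptpNormFun_star_le (φ : (∀ i, Ω i) → ℂ) :
    iptpNormFun.{w} P (star φ) ≤ iptpNormFun.{w} P φ := by
  refine le_of_forall_gt fun c hc => ?_
  obtain ⟨D, g, hg, hfg, hlt⟩ := exists_ipd_dominated hc
  refine lt_of_le_of_lt (iptpNormFun_le_lintegral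
    (f := fun i z => starRingEnd ℂ (D.f i z)) (fun i => ?_) (fun i σ => ?_) hg ?_ ?_) hlt
  · exact Complex.continuous_conj.measurable.comp (D.measurable i)
  · rw [essSupNorm_star]; exact D.mem_Linfty i σ
  · simpa only [essSupNorm_star] using hfg
  · filter_upwards [D.eq_integral] with ω h1
    simp only [← map_prod]
    rw [integral_conj, ← h1]
    rfl

/-- On a one-point space with the Dirac measure, put `c` in a single slot `i₀` and `1` in all
others. -/
theorem iptpNormFun_const_le (c : ℂ) :
    iptpNormFun.{w} P (fun _ => c) ≤ ‖c‖ₑ := by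
  classical
  obtain ⟨i₀⟩ := ‹Nonempty ι›
  have h : ∀ i, essSupNorm (P i) (fun _ => if i = i₀ then c else 1) ≤
      if i = i₀ then ‖c‖ₑ else 1 := fun i => by
    refine (essSupNorm_const_le (P i) _).trans_eq ?_
    split_ifs <;> simp
  have := iptpNormFun_le_lintegral (P := P) (φ := fun _ => c) (S := PUnit.{w + 1})
    (ρ := Measure.dirac PUnit.unit) (f := fun i _ => if i = i₀ then c else 1)
    (g := fun _ => ‖c‖ₑ) (fun _ => measurable_const)
    (fun i _ => (h i).trans_lt (by split_ifs <;> simp)) measurable_const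
    (Eventually.of_forall fun _ => (Finset.prod_le_prod' fun i _ => h i).trans_eq
      (by simp)) (by simp)
  simpa using this

/-! ### Disjoint unions of parameter spaces and countable subadditivity. -/

theorem measurableEmbedding_sigmaMk {S : ℕ → Type*} [∀ n, MeasurableSpace (S n)] (n : ℕ) :
    MeasurableEmbedding (Sigma.mk n : S n → Σ n, S n) where
  injective := sigma_mk_injective
  measurable := fun _ ht => MeasurableSpace.measurableSet_iInf.1 ht n
  measurableSet_image' := by
    intro s hs
    refine MeasurableSpace.measurableSet_iInf.2 fun m => ?_
    change MeasurableSet (Sigma.mk m ⁻¹' (Sigma.mk n '' s))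
    rcases eq_or_ne m n with rfl | h
    · rwa [Set.preimage_image_eq _ sigma_mk_injective]
    · rw [Set.preimage_image_sigmaMk_of_ne h]; exact .empty

/-- The copies of the spanning sets of all summands form a countable cover, and each copy is charged
by its own summand only. -/
theorem sigmaFinite_sum_map_sigmaMk {S : ℕ → Type*} [∀ n, MeasurableSpace (S n)]
    (ρ : ∀ n, Measure (S n)) [∀ n, SigmaFinite (ρ n)] :
    SigmaFinite (Measure.sum fun n => (ρ n).map (Sigma.mk n)) := by
  refine Measure.sigmaFinite_of_countable
    (S := Set.range fun p : ℕ × ℕ => Sigma.mk p.1 '' spanningSets (ρ p.1) p.2)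
    (Set.countable_range _) ?_ ?_
  · rintro _ ⟨⟨n, m⟩, rfl⟩
    rw [Measure.sum_apply _ ((measurableEmbedding_sigmaMk n).measurableSet_image.2
      (measurableSet_spanningSets _ _)), tsum_eq_single n fun k hk => ?_,
      (measurableEmbedding_sigmaMk n).map_apply, Set.preimage_image_eq _ sigma_mk_injective]
    · exact measure_spanningSets_lt_top _ _
    · rw [(measurableEmbedding_sigmaMk k).map_apply, Set.preimage_image_sigmaMk_of_ne hk,
        measure_empty]
  · refine Set.eq_univ_of_forall fun ⟨n, s⟩ => ?_
    obtain ⟨m, hm⟩ := Set.mem_iUnion.1 ((iUnion_spanningSets (ρ n)).symm.subset (Set.mem_univ s))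
    exact ⟨_, ⟨(n, m), rfl⟩, s, hm, rfl⟩

/-- Nearly optimal decompositions of the `ψ n`, placed side by side on the disjoint union of their
parameter spaces, decompose `φ`. Summability of `ψ n ω` need not be assumed: when the right side is
finite it follows almost everywhere from integrability on the union. -/
theorem iptpNormFun_le_tsum {φ : (∀ i, Ω i) → ℂ} {ψ : ℕ → (∀ i, Ω i) → ℂ}
    (h : ∀ᶠ ω in (tensorPVM P).ae, φ ω = ∑' n, ψ n ω) :
    iptpNormFun.{w} P φ ≤ ∑' n, iptpNormFun.{w} P (ψ n) := by
  rcases eq_top_or_lt_top (∑' n, iptpNormFun.{w} P (ψ n)) with ht | ht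
  · rw [ht]; exact le_top
  refine ENNReal.le_of_forall_pos_le_add fun ε hε _ => ?_
  -- The `n`-th decomposition may exceed the infimum by `δ n`, with total excess below `ε`.
  obtain ⟨δ, hδ, hδε⟩ := ENNReal.exists_pos_sum_of_countable' (ENNReal.coe_pos.2 hε).ne' ℕ
  have hlt : ∀ n, iptpNormFun.{w} P (ψ n) < iptpNormFun.{w} P (ψ n) + δ n := fun n =>
    ENNReal.lt_add_right (ENNReal.ne_top_of_tsum_ne_top ht.ne n) (hδ n).ne'
  choose D g hg hfg hgc using fun n => exists_ipd_dominated (hlt n)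
  have hsf := sigmaFinite_sum_map_sigmaMk fun n => (D n).ρ
  have hf : ∀ i, Measurable fun z : Ω i × Σ n, (D n).S => (D z.2.1).f i (z.1, z.2.2) := by
    intro i B hB
    -- Joint measurability is checked piece by piece, since `Ω i × Σ n, (D n).S` is the countable
    -- union of the embedded products `Ω i × (D n).S`.
    have he : (fun z : Ω i × Σ n, (D n).S => (D z.2.1).f i (z.1, z.2.2)) ⁻¹' B =
        ⋃ n, Prod.map id (Sigma.mk n) '' ((D n).f i ⁻¹' B) := by
      ext ⟨ω, n, s⟩
      simp only [Set.mem_preimage, Set.mem_iUnion, Set.mem_image, Prod.exists]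
      constructor
      · exact fun h => ⟨n, ω, s, h, rfl⟩
      · rintro ⟨m, ω', s', h, he⟩
        cases he
        exact h
    rw [he]
    exact .iUnion fun n => (MeasurableEmbedding.id.prodMap
      (measurableEmbedding_sigmaMk n)).measurableSet_image.2 ((D n).measurable i hB)
  have hgm : Measurable fun z : Σ n, (D n).S => g z.1 z.2 := fun B hB =>
    MeasurableSpace.measurableSet_iInf.2 fun n => hg n hB
  have hdom : ∀ᵐ z ∂Measure.sum fun n => (D n).ρ.map (Sigma.mk n),
      ∏ i, essSupNorm (P i) (fun ω => (D z.1).f i (ω, z.2)) ≤ g z.1 z.2 :=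
    Measure.ae_sum_iff.2 fun n => (measurableEmbedding_sigmaMk n).ae_map_iff.2 (hfg n)
  have hint : ∫⁻ z, g z.1 z.2 ∂(Measure.sum fun n => (D n).ρ.map (Sigma.mk n)) =
      ∑' n, ∫⁻ s, g n s ∂(D n).ρ := by
    rw [lintegral_sum_measure]
    exact tsum_congr fun n => (measurableEmbedding_sigmaMk n).lintegral_map _
  have hle : ∑' n, ∫⁻ s, g n s ∂(D n).ρ ≤ ∑' n, iptpNormFun.{w} P (ψ n) + ε :=
    calc ∑' n, ∫⁻ s, g n s ∂(D n).ρ ≤ ∑' n, (iptpNormFun.{w} P (ψ n) + δ n) :=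
          ENNReal.tsum_le_tsum fun n => (hgc n).le
      _ = ∑' n, iptpNormFun.{w} P (ψ n) + ∑' n, δ n := ENNReal.tsum_add
      _ ≤ _ := by gcongr
  refine le_trans (iptpNormFun_le_lintegral hf (fun i z => (D z.1).mem_Linfty i z.2) hgm hdom ?_)
    (hint.trans_le hle)
  filter_upwards [h, eventually_countable_forall.2 fun n => (D n).eq_integral,
    lintegral_enorm_prod_le P hf hgm hdom] with ω h1 h2 h3
  -- Integrability over the union comes from the domination estimate `h3`; it allows the integral to
  -- be split into the sum over the pieces.
  have hi : Integrable (fun z : Σ n, (D n).S => ∏ i, (D z.1).f i (ω i, z.2))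
      (Measure.sum fun n => (D n).ρ.map (Sigma.mk n)) :=
    ⟨((measurable_prod_comp hf).comp measurable_prodMk_left).aestronglyMeasurable,
      h3.trans_lt ((hint.trans_le hle).trans_lt (ENNReal.add_lt_top.2 ⟨ht, ENNReal.coe_lt_top⟩))⟩
  rw [h1, ← (hasSum_integral_measure hi).tsum_eq]
  refine tsum_congr fun n => ?_
  rw [h2 n, (measurableEmbedding_sigmaMk n).integral_map]

end decomposition

/-! ### The IPTP norm on classes in `L^∞`. -/

section norm

variable {ι : Type*} [Fintype ι] [Nonempty ι] {Ω : ι → Type*} [∀ i, MeasurableSpace (Ω i)]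
  {E : ι → Type*} [∀ i, NormedAddCommGroup (E i)] [∀ i, InnerProductSpace ℂ (E i)]
  [∀ i, CompleteSpace (E i)] {P : ∀ i, ProjectionValuedMeasure (Ω i) (E i)}

theorem iptpNorm_mk (f : ellInfty (∀ i, Ω i)) :
    iptpNorm.{w} P (Ideal.Quotient.mk (nullIdeal (tensorPVM P)) f) =
      iptpNormFun.{w} P (f : (∀ i, Ω i) → ℂ) := rfl

theorem norm_le_iptpNorm (x : Linfty (tensorPVM P)) :
    Linfty.norm (tensorPVM P) x ≤ iptpNorm.{w} P x := by
  obtain ⟨f, rfl⟩ := Ideal.Quotient.mk_surjective x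
  exact essSupNorm_le_iptpNormFun _

theorem iptpNorm_algebraMap_le (c : ℂ) :
    iptpNorm.{w} P (algebraMap ℂ (Linfty (tensorPVM P)) c) ≤ ‖c‖ₑ :=
  iptpNormFun_const_le c

theorem iptpNorm_one_le : iptpNorm.{w} P 1 ≤ 1 := by
  simpa using iptpNorm_algebraMap_le.{w} (P := P) 1

@[simp] theorem iptpNorm_zero : iptpNorm.{w} P 0 = 0 := by
  simpa using iptpNorm_algebraMap_le.{w} (P := P) 0

theorem iptpNorm_eq_zero_iff {x : Linfty (tensorPVM P)} : iptpNorm.{w} P x = 0 ↔ x = 0 := by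
  refine ⟨fun h => ?_, fun h => by rw [h, iptpNorm_zero]⟩
  exact Linfty.eq_zero_of_norm_eq_zero _ (le_antisymm ((norm_le_iptpNorm x).trans h.le) bot_le)

theorem iptpNorm_mul_le {x y : Linfty (tensorPVM P)} (hx : x ∈ iptp.{w} P) (hy : y ∈ iptp.{w} P) :
    iptpNorm.{w} P (x * y) ≤ iptpNorm.{w} P x * iptpNorm.{w} P y := by
  obtain ⟨f, rfl⟩ := Ideal.Quotient.mk_surjective x
  obtain ⟨g, rfl⟩ := Ideal.Quotient.mk_surjective y
  exact iptpNormFun_mul_le hx hy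

theorem iptpNorm_star (x : Linfty (tensorPVM P)) :
    iptpNorm.{w} P (star x) = iptpNorm.{w} P x := by
  have h : ∀ y : Linfty (tensorPVM P), iptpNorm.{w} P (star y) ≤ iptpNorm.{w} P y := by
    intro y
    obtain ⟨f, rfl⟩ := Ideal.Quotient.mk_surjective y
    exact iptpNormFun_star_le _
  exact (h x).antisymm (by simpa using h (star x))

/-- Countable subadditivity for the sequence `f, g, 0, 0, …`. -/
theorem iptpNorm_add_le (x y : Linfty (tensorPVM P)) :
    iptpNorm.{w} P (x + y) ≤ iptpNorm.{w} P x + iptpNorm.{w} P y := by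
  obtain ⟨f, rfl⟩ := Ideal.Quotient.mk_surjective x
  obtain ⟨g, rfl⟩ := Ideal.Quotient.mk_surjective y
  let u : ℕ → ellInfty (∀ i, Ω i) := fun n => if n = 0 then f else if n = 1 then g else 0
  have hu : ∀ n ∉ Finset.range 2, u n = 0 := by
    intro n hn
    rw [Finset.mem_range, not_lt] at hn
    simp [u, show n ≠ 0 by omega, show n ≠ 1 by omega]
  have h := iptpNormFun_le_tsum.{w} (P := P) (φ := ((f + g : ellInfty (∀ i, Ω i)) : (∀ i, Ω i) → ℂ))
    (ψ := fun n => (u n : (∀ i, Ω i) → ℂ)) (Eventually.of_forall fun ω => by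
      rw [tsum_eq_sum (s := Finset.range 2) fun n hn => by rw [hu n hn]; rfl]
      simp [Finset.sum_range_succ, u])
  rw [tsum_eq_sum (s := Finset.range 2) fun n hn => by
    rw [hu n hn]; exact iptpNorm_zero (P := P)] at h
  simp only [Finset.sum_range_succ, Finset.range_zero, Finset.sum_empty, zero_add, u, if_true,
    one_ne_zero, if_false] at h
  exact h

/-- Scaling is multiplication by a constant function, so the product estimate applies;
`iptpNorm_smul` gets the reverse inequality from `c⁻¹`. -/
theorem iptpNorm_smul_le (c : ℂ) {x : Linfty (tensorPVM P)} (hx : x ∈ iptp.{w} P) :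
    iptpNorm.{w} P (c • x) ≤ ‖c‖ₑ * iptpNorm.{w} P x := by
  rw [Algebra.smul_def]
  refine (iptpNorm_mul_le ?_ hx).trans (mul_le_mul_left (iptpNorm_algebraMap_le c) _)
  exact (iptpNorm_algebraMap_le c).trans_lt enorm_lt_top

theorem smul_mem_iptp (c : ℂ) {x : Linfty (tensorPVM P)} (hx : x ∈ iptp.{w} P) :
    c • x ∈ iptp.{w} P :=
  (iptpNorm_smul_le c hx).trans_lt (ENNReal.mul_lt_top enorm_lt_top hx)

theorem iptpNorm_smul (c : ℂ) {x : Linfty (tensorPVM P)} (hx : x ∈ iptp.{w} P) :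
    iptpNorm.{w} P (c • x) = ‖c‖ₑ * iptpNorm.{w} P x := by
  refine (iptpNorm_smul_le c hx).antisymm ?_
  rcases eq_or_ne c 0 with rfl | hc
  · simp
  have h := iptpNorm_smul_le c⁻¹ (smul_mem_iptp c hx)
  rw [inv_smul_smul₀ hc] at h
  calc ‖c‖ₑ * iptpNorm.{w} P x ≤ ‖c‖ₑ * (‖c⁻¹‖ₑ * iptpNorm.{w} P (c • x)) := by gcongr
    _ = iptpNorm.{w} P (c • x) := by
      rw [← mul_assoc, ← enorm_mul, mul_inv_cancel₀ hc, enorm_one, one_mul]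

/-! ### Completeness and the Banach *-algebra structure. -/

/-- An absolutely convergent series in the integral projective tensor product converges. -/
theorem exists_iptpNorm_sub_sum_le {x : ℕ → Linfty (tensorPVM P)}
    (h : ∑' n, iptpNorm.{w} P (x n) ≠ ∞) :
    ∃ y, ∀ m, iptpNorm.{w} P (y - ∑ n ∈ Finset.range m, x n) ≤
      ∑' n, iptpNorm.{w} P (x (n + m)) := by
  have hn : ∀ n, iptpNorm.{w} P (x n) ≠ ∞ := ENNReal.ne_top_of_tsum_ne_top h
  have hsum : Summable fun n => (iptpNorm.{w} P (x n)).toReal := ENNReal.summable_toReal h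
  -- The IPTP norm dominates the `L^∞` norm, so each representative can be bounded everywhere by the
  -- IPTP norm of its class. The series then converges absolutely at every point, and its sum `F` is
  -- bounded.
  choose f hfx hf using fun n => Linfty.exists_rep (tensorPVM P) (x n)
    (c := (iptpNorm.{w} P (x n)).toReal) ENNReal.toReal_nonneg
    ((norm_le_iptpNorm (x n)).trans_eq (ENNReal.ofReal_toReal (hn n)).symm)
  have hfs : ∀ ω, Summable fun n => (f n : (∀ i, Ω i) → ℂ) ω := fun ω =>
    Summable.of_norm_bounded hsum fun n => hf n ω
  let F : ellInfty (∀ i, Ω i) := ⟨fun ω => ∑' n, (f n : (∀ i, Ω i) → ℂ) ω,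
    Measurable.tsum fun n => (f n).2.1, _, fun ω => tsum_of_norm_bounded hsum.hasSum fun n => hf n ω⟩
  refine ⟨Ideal.Quotient.mk _ F, fun m => ?_⟩
  simp only [← hfx, ← map_sum, ← map_sub, iptpNorm_mk]
  refine iptpNormFun_le_tsum (Eventually.of_forall fun ω => ?_)
  have h1 : ((F - ∑ n ∈ Finset.range m, f n : ellInfty (∀ i, Ω i)) : (∀ i, Ω i) → ℂ) ω =
      ∑' n, (f n : (∀ i, Ω i) → ℂ) ω - ∑ n ∈ Finset.range m, (f n : (∀ i, Ω i) → ℂ) ω := by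
    simp [F]
  rw [h1, sub_eq_iff_eq_add', (hfs ω).sum_add_tsum_nat_add]

variable (P) in
/-- The integral projective tensor product as a *-subalgebra of `L^∞`. -/
def iptpSubalgebra : StarSubalgebra ℂ (Linfty (tensorPVM P)) where
  carrier := iptp.{w} P
  mul_mem' hx hy := (iptpNorm_mul_le hx hy).trans_lt (ENNReal.mul_lt_top hx hy)
  add_mem' hx hy := (iptpNorm_add_le _ _).trans_lt (ENNReal.add_lt_top.2 ⟨hx, hy⟩)
  algebraMap_mem' c := (iptpNorm_algebraMap_le c).trans_lt enorm_lt_top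
  star_mem' hx := (iptpNorm_star _).trans_lt hx

theorem iptpNorm_ne_top (x : iptpSubalgebra.{w} P) : iptpNorm.{w} P x ≠ ∞ := x.2.ne

variable (P) in
/-- The IPTP norm as a group norm on `iptpSubalgebra P`. -/
noncomputable def iptpGroupNorm : AddGroupNorm (iptpSubalgebra.{w} P) where
  toFun x := (iptpNorm.{w} P x).toReal
  map_zero' := by simp
  add_le' x y := by
    rw [← ENNReal.toReal_add (iptpNorm_ne_top x) (iptpNorm_ne_top y)]
    exact ENNReal.toReal_mono (ENNReal.add_ne_top.2 ⟨iptpNorm_ne_top x, iptpNorm_ne_top y⟩)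
      (iptpNorm_add_le _ _)
  neg' x := by
    have h := iptpNorm_smul (-1) x.2
    rw [neg_one_smul, enorm_neg, enorm_one, one_mul] at h
    exact congrArg ENNReal.toReal h
  eq_zero_of_map_eq_zero' x hx := by
    rcases (ENNReal.toReal_eq_zero_iff _).1 hx with h | h
    · exact Subtype.ext (iptpNorm_eq_zero_iff.1 h)
    · exact absurd h (iptpNorm_ne_top x)

theorem exists_tendsto_sum_iptpGroupNorm {u : ℕ → iptpSubalgebra.{w} P}
    (hu : Summable fun n => iptpGroupNorm.{w} P (u n)) :
    ∃ a, Tendsto (fun m => iptpGroupNorm.{w} P (∑ n ∈ Finset.range m, u n - a)) atTop (nhds 0) := by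
  have ht : ∑' n, iptpNorm.{w} P (u n) ≠ ∞ := by
    have h : ∀ n, iptpNorm.{w} P (u n) = ENNReal.ofReal (iptpGroupNorm.{w} P (u n)) := fun n =>
      (ENNReal.ofReal_toReal (iptpNorm_ne_top (u n))).symm
    simp only [h]
    rw [← ENNReal.ofReal_tsum_of_nonneg (fun _ => apply_nonneg _ _) hu]
    exact ENNReal.ofReal_ne_top
  obtain ⟨y, hy⟩ := exists_iptpNorm_sub_sum_le ht
  -- The remainder estimate with `m = 0` bounds the norm of `y` itself by the full sum.
  have hmem : y ∈ iptpSubalgebra.{w} P := by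
    have := hy 0
    simp only [Finset.range_zero, Finset.sum_empty, sub_zero, add_zero] at this
    exact this.trans_lt ht.lt_top
  refine ⟨⟨y, hmem⟩, ?_⟩
  simp only [← map_sub_rev _ (⟨y, hmem⟩ : iptpSubalgebra.{w} P)]
  have h0 := (ENNReal.tendsto_toReal ENNReal.zero_ne_top).comp
    (ENNReal.tendsto_sum_nat_add (fun n => iptpNorm.{w} P (u n)) ht)
  refine squeeze_zero (fun _ => ENNReal.toReal_nonneg) (fun m => ?_) h0
  refine ENNReal.toReal_mono ?_ ?_
  · exact ne_top_of_le_ne_top ht (ENNReal.tsum_comp_le_tsum_of_injective (add_left_injective m) _)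
  · simpa using hy m

theorem isBanachStarAlgebraNorm_iptpNorm :
    IsBanachStarAlgebraNorm (iptpSubalgebra.{w} P) fun x => (iptpNorm.{w} P x).toReal where
  nonneg _ := ENNReal.toReal_nonneg
  eq_zero_iff a := by
    rw [ENNReal.toReal_eq_zero_iff, or_iff_left (iptpNorm_ne_top a), iptpNorm_eq_zero_iff,
      ZeroMemClass.coe_eq_zero]
  add_le := map_add_le_add (iptpGroupNorm.{w} P)
  smul c a := by
    change (iptpNorm.{w} P (c • (a : Linfty (tensorPVM P)))).toReal = _
    rw [iptpNorm_smul c a.2, ENNReal.toReal_mul, toReal_enorm]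
  mul_le a b := by
    rw [← ENNReal.toReal_mul]
    exact ENNReal.toReal_mono (ENNReal.mul_ne_top (iptpNorm_ne_top a) (iptpNorm_ne_top b))
      (iptpNorm_mul_le a.2 b.2)
  norm_one _ := by
    have h1 : iptpNorm.{w} P ((1 : iptpSubalgebra.{w} P) : Linfty (tensorPVM P)) ≠ 0 := fun h =>
      one_ne_zero (Subtype.ext (iptpNorm_eq_zero_iff.1 h) : (1 : iptpSubalgebra.{w} P) = 0)
    -- From `1 * 1 = 1` the norm `N` of the unit satisfies `N ≤ N * N`; as `N` is nonzero and
    -- finite, cancelling gives `1 ≤ N`.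
    have h2 := iptpNorm_mul_le (1 : iptpSubalgebra.{w} P).2 (1 : iptpSubalgebra.{w} P).2
    rw [← MulMemClass.coe_mul, mul_one] at h2
    have h3 : 1 ≤ iptpNorm.{w} P ((1 : iptpSubalgebra.{w} P) : Linfty (tensorPVM P)) := by
      rwa [← ENNReal.mul_le_mul_iff_right h1 (iptpNorm_ne_top 1), mul_one]
    rw [h3.antisymm' iptpNorm_one_le, ENNReal.toReal_one]
  norm_star a := congrArg ENNReal.toReal (iptpNorm_star (a : Linfty (tensorPVM P)))
  complete u hu := by
    let _ : NormedAddCommGroup (iptpSubalgebra.{w} P) :=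
      (iptpGroupNorm.{w} P).toNormedAddCommGroup
    -- A normed group is complete once its absolutely summable series converge.
    have : CompleteSpace (iptpSubalgebra.{w} P) := by
      refine NormedAddCommGroup.completeSpace_of_summable_imp_tendsto fun v hv => ?_
      obtain ⟨a, ha⟩ := exists_tendsto_sum_iptpGroupNorm hv
      exact ⟨a, tendsto_iff_norm_sub_tendsto_zero.2 ha⟩
    have hc : CauchySeq u := Metric.cauchySeq_iff.2 fun ε hε => by
      obtain ⟨n₀, h⟩ := hu ε hε
      exact ⟨n₀, fun m hm n hn => by rw [dist_eq_norm]; exact h m hm n hn⟩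
    obtain ⟨a, ha⟩ := cauchySeq_tendsto_of_complete hc
    exact ⟨a, tendsto_iff_norm_sub_tendsto_zero.1 ha⟩

end norm

end IPTP

theorem proposition4p3 (k : ℕ) {Ω : Fin (k + 1) → Type u} [∀ j, MeasurableSpace (Ω j)]
    {H : Fin (k + 1) → Type v} [∀ j, NormedAddCommGroup (H j)]
    [∀ j, InnerProductSpace ℂ (H j)] [∀ j, CompleteSpace (H j)]
    (P : ∀ j, ProjectionValuedMeasure (Ω j) (H j)) :
    (∀ φ ∈ iptp.{w} P, Linfty.norm (tensorPVM P) φ ≤ iptpNorm.{w} P φ) ∧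
    ∃ B : StarSubalgebra ℂ (Linfty (tensorPVM P)),
      (B : Set (Linfty (tensorPVM P))) = iptp.{w} P ∧
      IsBanachStarAlgebraNorm B fun φ => (iptpNorm.{w} P (φ : Linfty (tensorPVM P))).toReal :=
  ⟨fun φ _ => norm_le_iptpNorm φ, iptpSubalgebra.{w} P, rfl, isBanachStarAlgebraNorm_iptpNorm⟩
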